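/- \textbf{TEF constraint.} Write $\llbracket x\rrbracket$ for the indicator function of the point $x\in[0,\infty)$. A line transition $g\to h$ between finitely supported functions $g,h:[0,\infty)\to[0,\infty)$ satisfies the \emph{TEF constraint} if it can be written as $$\sum_{i=1}^{n_k}p_{k_i}\llbracket x_{k_i}\rrbracket+\sum_{i=1}^{n_g}p_{g_i}\llbracket x_{g_i}\rrbracket\;\to\;\sum_{i=1}^{n_h}p_{h_i}\llbracket x_{h_i}\rrbracket+\sum_{i=1}^{n_k}p_{k_i}\llbracket x_{k_i}\rrbracket$$ with all weights $p$ positive, such that there is a unitary $U$ on the space with orthonormal basis $\{|g_i\rangle\}_{i=1}^{n_g}\cup\{|h_i\rangle\}_{i=1}^{n_h}$ with $$U\sum_i\sqrt{p_{g_i}}\,|g_i\rangle=\sum_i\sqrt{p_{h_i}}\,|h_i\rangle,\qquad \sum_i x_{h_i}|h_i\rangle\langle h_i|\;\ge\;\sum_i x_{g_i}\,E_hU|g_i\rangle\langle g_i|U^\dagger E_h,\qquad E_h=\sum_i|h_i\rangle\langle h_i| .$$ (The first condition includes $\sum_i p_{g_i}=\sum_i p_{h_i}$.) \textbf{Point game.}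 A time-dependent point game is a sequence $g_0,\dots,g_n$ of finitely supported functions $[0,\infty)^2\to[0,\infty)$ with $g_0=\frac12\llbracket 0,1\rrbracket+\frac12\llbracket 1,0\rrbracket$ and $g_n=\llbracket\beta,\alpha\rrbracket$ for some $\alpha,\beta\in[0,1]$. Assume that every transition satisfies the TEF constraint: for every even $i<n$ and every $x\ge0$ the line transition $g_i(x,\cdot)\to g_{i+1}(x,\cdot)$ satisfies it, and for every odd $i<n$ and every $y\ge0$ the line transition $g_i(\cdot,y)\to g_{i+1}(\cdot,y)$ satisfies it. \textbf{Protocol.} An $N$-message weak coin flipping (WCF) protocol, $N$ even, consists of finite-dimensional Hilbert spaces $A,M,B$, a product unit vector $|\psi_0\rangle=|\psi_{A,0}\rangle|\psi_{M,0}\rangle|\psi_{B,0}\rangle$, unitaries $U_1,\dots,U_N$ and projectors $E_1,\dots,E_N$, acting only on $A\otimes M$ for odd $i$ and only on $M\otimes B$ for even $i$, with $E_i|\psi_i\rangle=|\psi_i\rangle$ for $|\psi_i\rangle=U_i\cdots U_1|\psi_0\rangle$, and POVMs $\{\Pi_A^{(0)},\Pi_A^{(1)}\}$ on $A$, $\{\Pi_B^{(0)},\Pi_B^{(1)}\}$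 on $B$ with $\Pi_A^{(0)}\otimes\mathbb I_M\otimes\Pi_B^{(1)}|\psi_N\rangle=\Pi_A^{(1)}\otimes\mathbb I_M\otimes\Pi_B^{(0)}|\psi_N\rangle=0$ and $\|\Pi_A^{(j)}\otimes\mathbb I_M\otimes\Pi_B^{(j)}|\psi_N\rangle\|^2=\frac12$ for $j=0,1$. For $i=1,\dots,N$ the active party (Alice for odd $i$, Bob for even $i$) applies $U_i$, measures $\{E_i,\mathbb I-E_i\}$, declares themselves the winner on the second outcome, and otherwise passes $M$ on; finally both measure their POVMs. Outcome $0$ means that Alice wins and outcome $1$ that Bob wins. $P_B^*$ (resp. $P_A^*$) is the supremum, over all strategies of a cheating Bob (resp. Alice), who may use any finite-dimensional workspace, choose the joint initial state of the workspace and $M$ (as in the primal semidefinite program) and apply any unitary to them in each of their turns, of the probability that honest Alice outputs $1$ (resp. honest Bob outputs $0$). \emph{Dual feasible certificates} are positive semidefinite $Z_{A,0},\dots,Z_{A,N}$ on $A$ and $Z_{B,0},\dots,Z_{B,N}$ on $B$ with $Z_{A,N}=\Pi_A^{(1)}$, $Z_{B,N}=\Pi_B^{(0)}$ and, for $1\le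 i\le N$, \begin{itemize} \item for $i$ odd: $Z_{A,i-1}\otimes\mathbb I_M\ge U_i^\dagger E_i(Z_{A,i}\otimes\mathbb I_M)E_iU_i$ and $Z_{B,i-1}=Z_{B,i}$; \item for $i$ even: $\mathbb I_M\otimes Z_{B,i-1}\ge U_i^\dagger E_i(\mathbb I_M\otimes Z_{B,i})E_iU_i$ and $Z_{A,i-1}=Z_{A,i}$. \end{itemize} (Here $U_i,E_i$ are regarded as operators on $A\otimes M$, resp. $M\otimes B$.) The point game of the protocol and its certificates has the frames $f_j=\mathrm{Prob}[Z_{A,N-j},Z_{B,N-j},\psi_{N-j}]$, $j=0,\dots,N$, where $\mathrm{Prob}[Z_A,Z_B,\psi](z_A,z_B)=\langle\psi|\Pi_{Z_A}^{[z_A]}\otimes\mathbb I_M\otimes\Pi_{Z_B}^{[z_B]}|\psi\rangle$ and $\Pi_Z^{[z]}$ is the projector onto $\ker(Z-z)$. \textbf{Theorem.} If every transition of a time-dependent point game $g_0,\dots,g_n$ with final point $\llbracket\beta,\alpha\rrbracket$ satisfies the TEF constraint, then there are a WCF protocol and dual feasible certificates for it whose point game $f_0,\dots,f_N$ is $g_0,\dots,g_n$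 up to repeated frames: $f_j=g_{\sigma(j)}$ for a nondecreasing surjection $\sigma:\{0,\dots,N\}\to\{0,\dots,n\}$. The dual objective values are $\langle\psi_{A,0}|Z_{A,0}|\psi_{A,0}\rangle=\beta$ and $\langle\psi_{B,0}|Z_{B,0}|\psi_{B,0}\rangle=\alpha$, and hence $P_B^*\le\beta$ and $P_A^*\le\alpha$. -/

import Mathlib

open scoped NNReal ENNReal Kronecker Matrix ComplexOrder

noncomputable section

namespace WCF

/-! ### Finite-dimensional quantum mechanics in coordinates

A finite-dimensional Hilbert space with a fixed orthonormal basis is represented by the finite type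
of its basis labels: vectors are functions `ι → ℂ`, operators are matrices. The space
`A ⊗ M ⊗ B` has the label type `a × m × b`. -/

/-- The squared norm `⟨v|v⟩`. -/
def normSq {ι : Type} [Fintype ι] (v : ι → ℂ) : ℝ := ∑ i, ‖v i‖ ^ 2

/-- The expectation value `⟨v|M|v⟩` (real for Hermitian `M`). -/
def expect {ι : Type} [Fintype ι] (M : Matrix ι ι ℂ) (v : ι → ℂ) : ℝ :=
  (star v ⬝ᵥ (M *ᵥ v)).re

/-- The Loewner order `X ≥ Y`: the difference `X - Y` is positive semidefinite. -/
def LoewnerGE {ι : Type} [Fintype ι] (X Y : Matrix ι ι ℂ) : Prop := (X - Y).PosSemidef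

/-- `T ↦ T ⊗ 𝕀_B`, for an operator `T` on `A ⊗ M`. -/
def liftA {a m b : Type} [DecidableEq b] (T : Matrix (a × m) (a × m) ℂ) :
    Matrix (a × m × b) (a × m × b) ℂ :=
  Matrix.reindex (Equiv.prodAssoc a m b) (Equiv.prodAssoc a m b) (T ⊗ₖ (1 : Matrix b b ℂ))

/-- `T ↦ 𝕀_A ⊗ T`, for an operator `T` on `M ⊗ B`. -/
def liftB {a m b : Type} [DecidableEq a] (T : Matrix (m × b) (m × b) ℂ) :
    Matrix (a × m × b) (a × m × b) ℂ :=
  (1 : Matrix a a ℂ) ⊗ₖ T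

/-- The orthogonal projector `Π^[z]` onto the eigenspace of `Z` for `z`; it is `0` when `z` is not
an eigenvalue. -/
def eigProj {ι : Type} [Fintype ι] [DecidableEq ι] (Z : Matrix ι ι ℂ) (z : ℝ) : Matrix ι ι ℂ :=
  (Matrix.toEuclideanCLM (n := ι) (𝕜 := ℂ)).symm
    (Module.End.eigenspace (Matrix.toEuclideanLin Z) (z : ℂ)).starProjection

/-- `Prob[Z_A, Z_B, ψ](z_A, z_B) = ⟨ψ| Π^[z_A] ⊗ 𝕀_M ⊗ Π^[z_B] |ψ⟩`. -/
def prob {a m b : Type} [Fintype a] [Fintype m] [Fintype b]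
    [DecidableEq a] [DecidableEq m] [DecidableEq b]
    (ZA : Matrix a a ℂ) (ZB : Matrix b b ℂ) (ψ : a × m × b → ℂ) (z : ℝ≥0 × ℝ≥0) : ℝ :=
  expect (eigProj ZA z.1 ⊗ₖ ((1 : Matrix m m ℂ) ⊗ₖ eigProj ZB z.2)) ψ

/-! ### Point games -/

/-- `⟦x⟧`, the indicator function of the point `x`. -/
def mpoint (x : ℝ≥0) : ℝ≥0 → ℝ≥0 := fun z => if z = x then 1 else 0

/-- `∑ i, p i ⟦x i⟧`, the points `x i` on a line with weights `p i`. -/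
def linePoints {n : ℕ} (x p : Fin n → ℝ≥0) : ℝ≥0 → ℝ≥0 := fun z => ∑ i, p i * mpoint (x i) z

/-- The orthonormal basis `{|g_i⟩} ∪ {|h_i⟩}` is labelled by `Fin ng ⊕ Fin nh`. The matrix `U` on
its span solves the transition `∑ pg_i ⟦xg_i⟧ → ∑ ph_i ⟦xh_i⟧` if it is unitary,
`U |v⟩ = |w⟩` for `|v⟩ = ∑ √pg_i |g_i⟩` and `|w⟩ = ∑ √ph_i |h_i⟩`, and
`∑ xh_i |h_i⟩⟨h_i| ≥ ∑ xg_i E U |g_i⟩⟨g_i| U† E`, with `E` the projector on `span {|h_i⟩}`.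
The vectors `v` and `w` are not normalised; in terms of normalised vectors the second condition
says that `∑ pg_i = ∑ ph_i` and that `U` maps one normalised vector to the other. -/
def Solves {ng nh : ℕ} (xg pg : Fin ng → ℝ≥0) (xh ph : Fin nh → ℝ≥0)
    (U : Matrix (Fin ng ⊕ Fin nh) (Fin ng ⊕ Fin nh) ℂ) : Prop :=
  let v : Fin ng ⊕ Fin nh → ℂ := Sum.elim (fun i => ((√(pg i : ℝ) : ℝ) : ℂ)) (fun _ => 0)
  let w : Fin ng ⊕ Fin nh → ℂ := Sum.elim (fun _ => 0) (fun i => ((√(ph i : ℝ) : ℝ) : ℂ))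
  let E : Matrix (Fin ng ⊕ Fin nh) (Fin ng ⊕ Fin nh) ℂ :=
    ∑ i, Matrix.single (Sum.inr i) (Sum.inr i) 1
  U ∈ Matrix.unitaryGroup (Fin ng ⊕ Fin nh) ℂ ∧
  U *ᵥ v = w ∧
  LoewnerGE
    (∑ i, ((xh i : ℝ) : ℂ) • Matrix.single (Sum.inr i) (Sum.inr i) (1 : ℂ))
    (∑ i, ((xg i : ℝ) : ℂ) •
      (E * U * Matrix.single (Sum.inl i) (Sum.inl i) (1 : ℂ) * Uᴴ * E))

/-- The TEF constraint for a line transition `g → h`: it can be written as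
`∑ pk_i ⟦xk_i⟧ + ∑ pg_i ⟦xg_i⟧ → ∑ ph_i ⟦xh_i⟧ + ∑ pk_i ⟦xk_i⟧`, where the points `xk_i` are left
unchanged, and some unitary solves the transition of the remaining points. -/
def TEFLine (g h : ℝ≥0 → ℝ≥0) : Prop :=
  ∃ (nk ng nh : ℕ) (xk pk : Fin nk → ℝ≥0) (xg pg : Fin ng → ℝ≥0) (xh ph : Fin nh → ℝ≥0),
    (∀ i, 0 < pk i) ∧ (∀ i, 0 < pg i) ∧ (∀ i, 0 < ph i) ∧
    g = linePoints xk pk + linePoints xg pg ∧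
    h = linePoints xh ph + linePoints xk pk ∧
    ∃ U, Solves xg pg xh ph U

/-- A frame: a finitely supported function `[0,∞) × [0,∞) → [0,∞)`. -/
abbrev Frame := (ℝ≥0 × ℝ≥0) →₀ ℝ≥0

/-- A horizontal transition satisfying the TEF constraint on every horizontal line. -/
def TEFHorizontal (g h : Frame) : Prop := ∀ y, TEFLine (fun x => g (x, y)) (fun x => h (x, y))

/-- A vertical transition satisfying the TEF constraint on every vertical line. -/
def TEFVertical (g h : Frame) : Prop := ∀ x, TEFLine (fun y => g (x, y)) (fun y => h (x, y))

/-- The frames `g_0, …, g_n` of a time-dependent point game with final point `⟦β, α⟧`. The rule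
that the transitions obey is stated separately. -/
structure PointGame where
  n : ℕ
  frame : ℕ → Frame
  β : ℝ≥0
  α : ℝ≥0
  β_le : β ≤ 1
  α_le : α ≤ 1
  initial : frame 0 = Finsupp.single (0, 1) (1 / 2) + Finsupp.single (1, 0) (1 / 2)
  final : frame n = Finsupp.single (β, α) 1

/-- Every transition satisfies the TEF constraint; `g_i → g_{i+1}` is vertical for even `i` and
horizontal for odd `i`. -/
def PointGame.IsTEF (G : PointGame) : Prop :=
  ∀ i < G.n,
    (Even i → TEFVertical (G.frame i) (G.frame (i + 1))) ∧
    (Odd i → TEFHorizontal (G.frame i) (G.frame (i + 1)))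

/-! ### Weak coin flipping protocols -/

/-- The data of an `n`-message protocol. In message `i`, for `1 ≤ i ≤ n`, Alice (`i` odd) applies
`UA i` and the measurement `{EA i, 1 - EA i}` on `A ⊗ M`, and Bob (`i` even) applies `UB i` and
`{EB i, 1 - EB i}` on `M ⊗ B`; the values at other indices play no role. `PA` and `PB` are the
final measurements, with outcome `0` when Alice wins and `1` when Bob wins. -/
structure ProtocolData (a m b : Type) where
  n : ℕ
  ψA : a → ℂ
  ψM : m → ℂ
  ψB : b → ℂ
  UA : ℕ → Matrix (a × m) (a × m) ℂ
  UB : ℕ → Matrix (m × b) (m × b) ℂ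
  EA : ℕ → Matrix (a × m) (a × m) ℂ
  EB : ℕ → Matrix (m × b) (m × b) ℂ
  PA : Fin 2 → Matrix a a ℂ
  PB : Fin 2 → Matrix b b ℂ

section
variable {a m b : Type} [Fintype a] [Fintype m] [Fintype b]
  [DecidableEq a] [DecidableEq m] [DecidableEq b]

/-- The honest states `|ψ_i⟩ = U_i ⋯ U_1 |ψ_0⟩`, with `|ψ_0⟩ = |ψ_A⟩|ψ_M⟩|ψ_B⟩`. -/
def ProtocolData.honest (P : ProtocolData a m b) : ℕ → (a × m × b → ℂ)
  | 0 => fun s => P.ψA s.1 * P.ψM s.2.1 * P.ψB s.2.2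
  | i + 1 =>
    if Odd (i + 1) then liftA (P.UA (i + 1)) *ᵥ P.honest i
    else liftB (P.UB (i + 1)) *ᵥ P.honest i

/-- `Π_A^(j) ⊗ 𝕀_M ⊗ Π_B^(k)`. -/
def ProtocolData.joint (P : ProtocolData a m b) (j k : Fin 2) :
    Matrix (a × m × b) (a × m × b) ℂ :=
  P.PA j ⊗ₖ ((1 : Matrix m m ℂ) ⊗ₖ P.PB k)

variable (a m b) in
/-- A weak coin flipping protocol with an even number of messages, correct and balanced. -/
structure Protocol extends ProtocolData a m b where
  n_even : Even n
  ψA_unit : normSq ψA = 1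
  ψM_unit : normSq ψM = 1
  ψB_unit : normSq ψB = 1
  UA_unitary : ∀ i ≤ n, Odd i → UA i ∈ Matrix.unitaryGroup (a × m) ℂ
  UB_unitary : ∀ i ≤ n, Even i → 0 < i → UB i ∈ Matrix.unitaryGroup (m × b) ℂ
  EA_proj : ∀ i ≤ n, Odd i → IsStarProjection (EA i)
  EB_proj : ∀ i ≤ n, Even i → 0 < i → IsStarProjection (EB i)
  EA_honest : ∀ i ≤ n, Odd i → liftA (EA i) *ᵥ toProtocolData.honest i = toProtocolData.honest i
  EB_honest : ∀ i ≤ n, Even i → 0 < i →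
    liftB (EB i) *ᵥ toProtocolData.honest i = toProtocolData.honest i
  PA_psd : ∀ j, (PA j).PosSemidef
  PB_psd : ∀ j, (PB j).PosSemidef
  PA_sum : PA 0 + PA 1 = 1
  PB_sum : PB 0 + PB 1 = 1
  correct₀₁ : toProtocolData.joint 0 1 *ᵥ toProtocolData.honest n = 0
  correct₁₀ : toProtocolData.joint 1 0 *ᵥ toProtocolData.honest n = 0
  balanced₀ : normSq (toProtocolData.joint 0 0 *ᵥ toProtocolData.honest n) = 1 / 2
  balanced₁ : normSq (toProtocolData.joint 1 1 *ᵥ toProtocolData.honest n) = 1 / 2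

/-- The (unnormalised) joint state after `i` messages when Alice is honest and all her checks so far
have passed, while a cheating Bob has a workspace of dimension `d`, starts from the state `χ` of
`M` and his workspace, and applies `V i` for even `i`. -/
def Protocol.stateBobCheats (P : Protocol a m b) {d : ℕ} (χ : m × Fin d → ℂ)
    (V : ℕ → Matrix (m × Fin d) (m × Fin d) ℂ) : ℕ → (a × m × Fin d → ℂ)
  | 0 => fun s => P.ψA s.1 * χ s.2
  | i + 1 =>
    if Odd (i + 1) then liftA (P.EA (i + 1) * P.UA (i + 1)) *ᵥ P.stateBobCheats χ V i
    else liftB (V (i + 1)) *ᵥ P.stateBobCheats χ V i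

/-- The same with the roles of Alice and Bob exchanged: Alice applies `V i` for odd `i`. -/
def Protocol.stateAliceCheats (P : Protocol a m b) {d : ℕ} (χ : Fin d × m → ℂ)
    (V : ℕ → Matrix (Fin d × m) (Fin d × m) ℂ) : ℕ → (Fin d × m × b → ℂ)
  | 0 => fun s => χ (s.1, s.2.1) * P.ψB s.2.2
  | i + 1 =>
    if Odd (i + 1) then liftA (V (i + 1)) *ᵥ P.stateAliceCheats χ V i
    else liftB (P.EB (i + 1) * P.UB (i + 1)) *ᵥ P.stateAliceCheats χ V i

/-- `P_B^*`: the supremum, over all strategies of a cheating Bob, of the probability that the honest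
Alice does not abort and outputs `1`. The cheater may choose the initial state of the message space
too; strategies starting from the prescribed `ψM` are those with `χ = ψM ⊗ φ`. -/
def Protocol.cheatB (P : Protocol a m b) : ℝ≥0∞ :=
  ⨆ (d : ℕ) (χ : m × Fin d → ℂ) (_ : normSq χ = 1)
    (V : ℕ → Matrix (m × Fin d) (m × Fin d) ℂ)
    (_ : ∀ i, V i ∈ Matrix.unitaryGroup (m × Fin d) ℂ),
    ENNReal.ofReal (expect (P.PA 1 ⊗ₖ (1 : Matrix (m × Fin d) (m × Fin d) ℂ))
      (P.stateBobCheats χ V P.n))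

/-- `P_A^*`: the supremum, over all strategies of a cheating Alice, of the probability that the
honest Bob does not abort and outputs `0`. -/
def Protocol.cheatA (P : Protocol a m b) : ℝ≥0∞ :=
  ⨆ (d : ℕ) (χ : Fin d × m → ℂ) (_ : normSq χ = 1)
    (V : ℕ → Matrix (Fin d × m) (Fin d × m) ℂ)
    (_ : ∀ i, V i ∈ Matrix.unitaryGroup (Fin d × m) ℂ),
    ENNReal.ofReal (expect ((1 : Matrix (Fin d) (Fin d) ℂ) ⊗ₖ ((1 : Matrix m m ℂ) ⊗ₖ P.PB 0))
      (P.stateAliceCheats χ V P.n))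

/-- `ZA 0, …, ZA n` and `ZB 0, …, ZB n` are feasible for the two dual semidefinite programs of the
protocol. -/
structure Protocol.IsDualFeasible (P : Protocol a m b)
    (ZA : ℕ → Matrix a a ℂ) (ZB : ℕ → Matrix b b ℂ) : Prop where
  psdA : ∀ i ≤ P.n, (ZA i).PosSemidef
  psdB : ∀ i ≤ P.n, (ZB i).PosSemidef
  stepA : ∀ i < P.n, Odd (i + 1) →
    LoewnerGE (ZA i ⊗ₖ (1 : Matrix m m ℂ))
      ((P.UA (i + 1))ᴴ * P.EA (i + 1) * (ZA (i + 1) ⊗ₖ (1 : Matrix m m ℂ))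
        * P.EA (i + 1) * P.UA (i + 1))
  idleA : ∀ i < P.n, Even (i + 1) → ZA i = ZA (i + 1)
  finalA : ZA P.n = P.PA 1
  stepB : ∀ i < P.n, Even (i + 1) →
    LoewnerGE ((1 : Matrix m m ℂ) ⊗ₖ ZB i)
      ((P.UB (i + 1))ᴴ * P.EB (i + 1) * ((1 : Matrix m m ℂ) ⊗ₖ ZB (i + 1))
        * P.EB (i + 1) * P.UB (i + 1))
  idleB : ∀ i < P.n, Odd (i + 1) → ZB i = ZB (i + 1)
  finalB : ZB P.n = P.PB 0

/-- The point game of a protocol with dual certificates, whose frames are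
`Prob[Z_{A,n-j}, Z_{B,n-j}, ψ_{n-j}]` for `j = 0, …, n` (in the reverse time order), is the game `G`
with some of its frames repeated. -/
def Protocol.HasPointGame (P : Protocol a m b)
    (ZA : ℕ → Matrix a a ℂ) (ZB : ℕ → Matrix b b ℂ) (G : PointGame) : Prop :=
  ∃ σ : Fin (P.n + 1) → Fin (G.n + 1), Monotone σ ∧ Function.Surjective σ ∧
    ∀ (j : Fin (P.n + 1)) (z : ℝ≥0 × ℝ≥0),
      prob (ZA (P.n - j)) (ZB (P.n - j)) (P.honest (P.n - j)) z = (G.frame (σ j) z : ℝ)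

end

end WCF

end

/-!
The protocol runs the point game backwards. While the game stands at the frame `f`, the joint state
is `∑ √(f (x, y)) |x⟩|x, y⟩|y⟩`: the message holds the point, and each party keeps a copy of its
own coordinate. Since the certificates are diagonal in the coordinates, the point game of these
states is the given one.

If a unitary `U` solves the line transition `g → h`, then the block of `U†` from the span of the
`|h_i⟩` to that of the `|g_i⟩` is a contraction `K` that takes the amplitudes of `h` to those of
`g`, and the operator inequality for `U` says that `K` does not increase the expectation of the
coordinate. The points that are left unchanged and the merging of equal points are absorbed by an
isometry into this picture, so each pair of neighbouring frames yields such a contraction on every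
line. The active party dilates these contractions to a single unitary; the part of the state lost
by `K` goes to labels `|none⟩` of the register, where the certificate vanishes. The check is the
projector onto the range of the dilation, so that it passes honest states, and the dual constraint
of the message reduces to the monotonicity of `K`. Weak duality then bounds the cheating
probabilities by the coordinates of the final point.
-/

noncomputable section

namespace WCF

open Matrix

section Expectation

variable {ι κ : Type} [Fintype ι] [Fintype κ]

theorem ofReal_normSq (v : ι → ℂ) : ((normSq v : ℝ) : ℂ) = star v ⬝ᵥ v := by
  simp only [normSq, Complex.ofReal_sum, Complex.ofReal_pow, dotProduct, Pi.star_apply,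
    RCLike.star_def, Complex.conj_mul']

theorem normSq_eq_zero {v : ι → ℂ} : normSq v = 0 ↔ v = 0 := by
  rw [← dotProduct_star_self_eq_zero, ← ofReal_normSq, Complex.ofReal_eq_zero]

theorem normSq_mulVec_of_isometry [DecidableEq κ] {V : Matrix ι κ ℂ} (hV : Vᴴ * V = 1)
    (u : κ → ℂ) : normSq (V *ᵥ u) = normSq u := by
  apply Complex.ofReal_injective
  rw [ofReal_normSq, ofReal_normSq, star_mulVec, ← dotProduct_mulVec, mulVec_mulVec, hV,
    one_mulVec]

theorem expect_conj (M : Matrix ι ι ℂ) (B : Matrix ι κ ℂ) (u : κ → ℂ) :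
    expect (Bᴴ * M * B) u = expect M (B *ᵥ u) := by
  simp only [expect, star_mulVec, ← dotProduct_mulVec, mulVec_mulVec, Matrix.mul_assoc]

theorem expect_sub (M N : Matrix ι ι ℂ) (u : ι → ℂ) :
    expect (M - N) u = expect M u - expect N u := by
  simp only [expect, sub_mulVec, dotProduct_sub, Complex.sub_re]

theorem expect_add (M N : Matrix ι ι ℂ) (u : ι → ℂ) :
    expect (M + N) u = expect M u + expect N u := by
  simp only [expect, add_mulVec, dotProduct_add, Complex.add_re]

theorem expect_conjTranspose_mul_self (K : Matrix ι κ ℂ) (u : κ → ℂ) :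
    expect (Kᴴ * K) u = normSq (K *ᵥ u) := by
  rw [expect, ← mulVec_mulVec, dotProduct_mulVec, ← star_mulVec, ← ofReal_normSq,
    Complex.ofReal_re]

theorem expect_submatrix (M : Matrix ι ι ℂ) (e : κ ≃ ι) (v : ι → ℂ) :
    expect (M.submatrix e e) (v ∘ e) = expect M v := by
  rw [expect, submatrix_mulVec_equiv, Function.comp_assoc, e.self_comp_symm, Function.comp_id,
    expect]
  exact congrArg Complex.re (comp_equiv_dotProduct_comp_equiv (star v) (M *ᵥ v) e)

theorem posSemidef_iff_expect_nonneg {M : Matrix ι ι ℂ} (hM : M.IsHermitian) :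
    M.PosSemidef ↔ ∀ u, 0 ≤ expect M u := by
  refine ⟨fun h u => (Complex.le_def.1 (h.dotProduct_mulVec_nonneg u)).1, fun h =>
    .of_dotProduct_mulVec_nonneg hM fun u => Complex.le_def.2 ⟨h u, ?_⟩⟩
  exact (hM.im_star_dotProduct_mulVec_self u).symm

theorem LoewnerGE.expect_le {M N : Matrix ι ι ℂ} (h : LoewnerGE M N) (u : ι → ℂ) :
    expect N u ≤ expect M u := by
  rw [← sub_nonneg, ← expect_sub]
  exact (posSemidef_iff_expect_nonneg h.isHermitian).1 h u

theorem loewnerGE_of_expect_le {M N : Matrix ι ι ℂ} (hM : M.IsHermitian) (hN : N.IsHermitian)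
    (h : ∀ u, expect N u ≤ expect M u) : LoewnerGE M N := by
  refine (posSemidef_iff_expect_nonneg (hM.sub hN)).2 fun u => ?_
  rw [expect_sub, sub_nonneg]
  exact h u

end Expectation

section Obs

variable {ι κ : Type} [DecidableEq ι] [DecidableEq κ]

/-- The observable that is diagonal in the label basis and has the value `w i` on `|i⟩`. -/
def obs (w : ι → ℝ) : Matrix ι ι ℂ := diagonal fun i => (w i : ℂ)

theorem isHermitian_obs (w : ι → ℝ) : (obs w).IsHermitian :=
  isHermitian_diagonal_of_self_adjoint _ <| by ext; simp

theorem posSemidef_obs {w : ι → ℝ} (hw : ∀ i, 0 ≤ w i) : (obs w).PosSemidef :=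
  posSemidef_diagonal_iff.2 fun i => Complex.zero_le_real.2 (hw i)

theorem obs_one : obs (fun _ : ι => 1) = 1 := by simp [obs]

theorem obs_add (w w' : ι → ℝ) : obs w + obs w' = obs (w + w') := by
  simp [obs, diagonal_add]

theorem obs_kronecker_obs (w : ι → ℝ) (w' : κ → ℝ) :
    obs w ⊗ₖ obs w' = obs fun p : ι × κ => w p.1 * w' p.2 := by
  simp only [obs, diagonal_kronecker_diagonal, Complex.ofReal_mul]

variable [Fintype ι]

theorem obs_mulVec (w : ι → ℝ) (v : ι → ℂ) : obs w *ᵥ v = fun i => (w i : ℂ) * v i := by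
  ext i
  rw [obs, mulVec_diagonal]

theorem expect_obs (w : ι → ℝ) (v : ι → ℂ) : expect (obs w) v = ∑ i, w i * ‖v i‖ ^ 2 := by
  rw [expect, obs_mulVec, dotProduct, Complex.re_sum]
  refine Finset.sum_congr rfl fun i _ => ?_
  rw [Pi.star_apply, RCLike.star_def, mul_left_comm, Complex.conj_mul', ← Complex.ofReal_pow,
    ← Complex.ofReal_mul, Complex.ofReal_re]

theorem normSq_obs_mulVec (w : ι → ℝ) (v : ι → ℂ) :
    normSq (obs w *ᵥ v) = expect (obs (w ^ 2)) v := by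
  simp [normSq, obs_mulVec, expect_obs, mul_pow]

theorem expect_obs_congr {w : ι → ℝ} {v v' : ι → ℂ} (h : ∀ i, w i ≠ 0 → v i = v' i) :
    expect (obs w) v = expect (obs w) v' := by
  rw [expect_obs, expect_obs]
  refine Finset.sum_congr rfl fun i _ => ?_
  rcases eq_or_ne (w i) 0 with hi | hi
  · rw [hi, zero_mul, zero_mul]
  · rw [h i hi]

theorem expect_obs_mono {w w' : ι → ℝ} (h : ∀ i, w i ≤ w' i) (v : ι → ℂ) :
    expect (obs w) v ≤ expect (obs w') v := by
  rw [expect_obs, expect_obs]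
  exact Finset.sum_le_sum fun i _ => mul_le_mul_of_nonneg_right (h i) (sq_nonneg _)

theorem expect_one (v : ι → ℂ) : expect 1 v = normSq v := by
  simp only [← obs_one, expect_obs, one_mul, normSq]

theorem expect_obs_single (w : ι → ℝ) (i : ι) : expect (obs w) (Pi.single i 1) = w i := by
  rw [expect_obs, Finset.sum_eq_single_of_mem i (Finset.mem_univ i)]
  · simp
  · intro j _ hj
    simp [hj]

theorem normSq_single (i : ι) : normSq (Pi.single i 1 : ι → ℂ) = 1 := by
  rw [← expect_one, ← obs_one, expect_obs_single]

end Obs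

section Ampl

variable {ι : Type}

/-- The unnormalised state `∑ √(p i) |i⟩` with weights `p`. -/
def ampl (p : ι → ℝ≥0) : ι → ℂ := fun i => ((√(p i : ℝ) : ℝ) : ℂ)

theorem norm_ampl_sq (p : ι → ℝ≥0) (i : ι) : ‖ampl p i‖ ^ 2 = p i := by
  rw [ampl, Complex.norm_real, Real.norm_of_nonneg (Real.sqrt_nonneg _),
    Real.sq_sqrt (p i).coe_nonneg]

variable [Fintype ι]

theorem normSq_ampl (p : ι → ℝ≥0) : normSq (ampl p) = ∑ i, (p i : ℝ) := by
  simp only [normSq, norm_ampl_sq]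

theorem expect_obs_ampl [DecidableEq ι] (w : ι → ℝ) (p : ι → ℝ≥0) :
    expect (obs w) (ampl p) = ∑ i, w i * p i := by
  simp only [expect_obs, norm_ampl_sq]

end Ampl

section Embed

variable {ι κ μ : Type} [DecidableEq ι]

/-- The operator `|k⟩ ↦ |f k⟩` that relabels basis vectors. -/
def embed (f : κ → ι) : Matrix ι κ ℂ := (1 : Matrix ι ι ℂ).submatrix id f

theorem conjTranspose_embed_mulVec [Fintype ι] (f : κ → ι) (v : ι → ℂ) :
    (embed f)ᴴ *ᵥ v = v ∘ f := by
  ext k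
  simp [embed, mulVec, dotProduct, one_apply]

theorem embed_mulVec_single [Fintype κ] [DecidableEq κ] (f : κ → ι) (k : κ) :
    embed f *ᵥ Pi.single k 1 = Pi.single (f k) 1 := by
  ext i
  simp [embed, one_apply, Pi.single_apply]

theorem embed_mulVec_apply [Fintype κ] {f : κ → ι} (hf : Function.Injective f) (u : κ → ℂ)
    (k : κ) : (embed f *ᵥ u) (f k) = u k := by
  classical
  simp [embed, mulVec, dotProduct, one_apply, hf.eq_iff]

theorem embed_mulVec_apply_of_ne [Fintype κ] {f : κ → ι} (u : κ → ℂ) {i : ι}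
    (hi : ∀ k, f k ≠ i) : (embed f *ᵥ u) i = 0 :=
  Finset.sum_eq_zero fun k _ => by simp [embed, one_apply, (hi k).symm]

theorem embed_isometry [Fintype ι] [DecidableEq κ] {f : κ → ι} (hf : Function.Injective f) :
    (embed f)ᴴ * embed f = 1 := by
  ext k l
  simp [embed, Matrix.mul_apply, one_apply, hf.eq_iff]

theorem conjTranspose_embed_mul_embed_eq_zero [Fintype ι] {f : κ → ι} {g : μ → ι}
    (h : ∀ k l, f k ≠ g l) : (embed f)ᴴ * embed g = 0 := by
  ext k l
  simp [embed, Matrix.mul_apply, one_apply, h k l]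

variable [Fintype ι] [Fintype κ] [DecidableEq κ]

theorem obs_mul_embed (w : ι → ℝ) (f : κ → ι) : obs w * embed f = embed f * obs (w ∘ f) := by
  ext i k
  rw [obs, obs, diagonal_mul, mul_diagonal, embed, submatrix_apply, one_apply]
  split_ifs with h
  · simp [← h]
  · simp

theorem expect_obs_embed (w : ι → ℝ) {f : κ → ι} (hf : Function.Injective f) (u : κ → ℂ) :
    expect (obs w) (embed f *ᵥ u) = expect (obs (w ∘ f)) u := by
  rw [← expect_conj, Matrix.mul_assoc, obs_mul_embed, ← Matrix.mul_assoc, embed_isometry hf,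
    Matrix.one_mul]

theorem expect_obs_comp_le {w : ι → ℝ} (hw : ∀ i, 0 ≤ w i) {f : κ → ι}
    (hf : Function.Injective f) (v : ι → ℂ) :
    expect (obs (w ∘ f)) (v ∘ f) ≤ expect (obs w) v := by
  rw [expect_obs, expect_obs]
  calc ∑ k, w (f k) * ‖v (f k)‖ ^ 2
      = ∑ i ∈ Finset.univ.map ⟨f, hf⟩, w i * ‖v i‖ ^ 2 :=
        (Finset.sum_map _ ⟨f, hf⟩ fun i => w i * ‖v i‖ ^ 2).symm
    _ ≤ ∑ i, w i * ‖v i‖ ^ 2 :=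
      Finset.sum_le_univ_sum_of_nonneg fun i => mul_nonneg (hw i) (sq_nonneg _)

end Embed

section Transfer

variable {ι κ μ ν : Type} [Fintype ι] [Fintype κ] [Fintype μ] [Fintype ν]
  [DecidableEq ι] [DecidableEq κ] [DecidableEq μ] [DecidableEq ν]

/-- The contraction `K` carries the weights `q` at the positions `y` to the weights `p` at the
positions `x`, and never increases the expected position. -/
structure IsTransfer (y q : κ → ℝ≥0) (x p : ι → ℝ≥0) (K : Matrix ι κ ℂ) : Prop where
  sum_eq : ∑ k, q k = ∑ i, p i
  mulVec_ampl : K *ᵥ ampl q = ampl p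
  normSq_le : ∀ u, normSq (K *ᵥ u) ≤ normSq u
  expect_le : ∀ u, expect (obs fun i => x i) (K *ᵥ u) ≤ expect (obs fun k => y k) u

theorem IsTransfer.refl (x p : ι → ℝ≥0) : IsTransfer x p x p 1 where
  sum_eq := rfl
  mulVec_ampl := one_mulVec _
  normSq_le u := by rw [one_mulVec]
  expect_le u := by rw [one_mulVec]

theorem IsTransfer.mul {x p : ι → ℝ≥0} {y q : κ → ℝ≥0} {z r : μ → ℝ≥0} {K : Matrix ι κ ℂ}
    {L : Matrix κ μ ℂ} (hK : IsTransfer y q x p K) (hL : IsTransfer z r y q L) :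
    IsTransfer z r x p (K * L) where
  sum_eq := hL.sum_eq.trans hK.sum_eq
  mulVec_ampl := by rw [← mulVec_mulVec, hL.mulVec_ampl, hK.mulVec_ampl]
  normSq_le u := by
    rw [← mulVec_mulVec]
    exact (hK.normSq_le _).trans (hL.normSq_le u)
  expect_le u := by
    rw [← mulVec_mulVec]
    exact (hK.expect_le _).trans (hL.expect_le u)

theorem IsTransfer.fromBlocks {x p : ι → ℝ≥0} {y q : κ → ℝ≥0} {x' p' : μ → ℝ≥0} {y' q' : ν → ℝ≥0}
    {K : Matrix ι κ ℂ} {L : Matrix μ ν ℂ} (hK : IsTransfer y q x p K)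
    (hL : IsTransfer y' q' x' p' L) :
    IsTransfer (Sum.elim y y') (Sum.elim q q') (Sum.elim x x') (Sum.elim p p')
      (fromBlocks K 0 0 L) where
  sum_eq := by
    simp only [Fintype.sum_sum_type, Sum.elim_inl, Sum.elim_inr, hK.sum_eq, hL.sum_eq]
  mulVec_ampl := by
    have h : ∀ {α β : Type} (a : α → ℝ≥0) (b : β → ℝ≥0),
        ampl (Sum.elim a b) = Sum.elim (ampl a) (ampl b) := fun a b => by
      ext (i | i) <;> rfl
    simp only [h, fromBlocks_mulVec, Sum.elim_comp_inl, Sum.elim_comp_inr, zero_mulVec, add_zero,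
      zero_add, hK.mulVec_ampl, hL.mulVec_ampl]
  normSq_le u := by
    simp only [normSq, Fintype.sum_sum_type, fromBlocks_mulVec, Sum.elim_inl, Sum.elim_inr,
      zero_mulVec, add_zero, zero_add]
    exact add_le_add (hK.normSq_le _) (hL.normSq_le _)
  expect_le u := by
    simp only [expect_obs, Fintype.sum_sum_type, fromBlocks_mulVec, Sum.elim_inl, Sum.elim_inr,
      zero_mulVec, add_zero, zero_add]
    have hK' := hK.expect_le (u ∘ Sum.inl)
    have hL' := hL.expect_le (u ∘ Sum.inr)
    rw [expect_obs, expect_obs] at hK' hL'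
    exact add_le_add hK' hL'

end Transfer

section Solves

theorem sum_smul_single {ι κ : Type} [Fintype ι] [DecidableEq ι] [DecidableEq κ] (f : ι → κ)
    (w : ι → ℝ) :
    ∑ i, (w i : ℂ) • single (f i) (f i) (1 : ℂ) = embed f * obs w * (embed f)ᴴ := by
  ext k l
  rw [Matrix.sum_apply, Matrix.mul_apply]
  simp only [Matrix.smul_apply, single_apply, obs, mul_diagonal, conjTranspose_apply, embed,
    submatrix_apply, one_apply, id]
  refine Finset.sum_congr rfl fun i _ => ?_
  by_cases hk : k = f i <;> by_cases hl : l = f i <;> simp [hk, hl, eq_comm]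

theorem expect_obs_le_of_loewnerGE_single {ι κ μ : Type} [Fintype ι] [Fintype κ] [Fintype μ]
    [DecidableEq ι] [DecidableEq κ] [DecidableEq μ] {f : ι → μ} {g : κ → μ}
    (hg : Function.Injective g) {x : ι → ℝ} {y : κ → ℝ} {U : Matrix μ μ ℂ}
    (h : LoewnerGE (∑ k, (y k : ℂ) • single (g k) (g k) (1 : ℂ))
      (∑ i, (x i : ℂ) • ((∑ k, single (g k) (g k) (1 : ℂ)) * U *
        single (f i) (f i) (1 : ℂ) * Uᴴ * ∑ k, single (g k) (g k) (1 : ℂ)))) (u : κ → ℂ) :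
    expect (obs x) (((embed f)ᴴ * Uᴴ * embed g) *ᵥ u) ≤ expect (obs y) u := by
  have hE : ∑ k, single (g k) (g k) (1 : ℂ) = embed g * (embed g)ᴴ := by
    simpa [obs_one] using sum_smul_single g fun _ => 1
  have hx : ∑ i, (x i : ℂ) • ((∑ k, single (g k) (g k) (1 : ℂ)) * U *
      single (f i) (f i) (1 : ℂ) * Uᴴ * ∑ k, single (g k) (g k) (1 : ℂ)) =
      ((embed f)ᴴ * Uᴴ * embed g * (embed g)ᴴ)ᴴ * obs x *
        ((embed f)ᴴ * Uᴴ * embed g * (embed g)ᴴ) := by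
    calc _ = embed g * (embed g)ᴴ * U * (∑ i, (x i : ℂ) • single (f i) (f i) (1 : ℂ)) * Uᴴ *
          (embed g * (embed g)ᴴ) := by
          simp only [hE, Finset.mul_sum, Finset.sum_mul, Matrix.mul_smul, Matrix.smul_mul]
      _ = _ := by
          rw [sum_smul_single]
          simp only [conjTranspose_mul, conjTranspose_conjTranspose, Matrix.mul_assoc]
  have hy : ∑ k, (y k : ℂ) • single (g k) (g k) (1 : ℂ) =
      (embed g)ᴴᴴ * obs y * (embed g)ᴴ := by
    rw [sum_smul_single, conjTranspose_conjTranspose]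
  have hu : (embed g)ᴴ *ᵥ (embed g *ᵥ u) = u := by
    rw [mulVec_mulVec, embed_isometry hg, one_mulVec]
  have hle := h.expect_le (embed g *ᵥ u)
  rwa [hx, hy, expect_conj, expect_conj, hu, ← mulVec_mulVec, hu] at hle

/-- The transfer runs against the direction of the transition: it is the block of `U†` from the
span of the `|h_i⟩` to the span of the `|g_i⟩`. -/
theorem Solves.isTransfer {ng nh : ℕ} {xg pg : Fin ng → ℝ≥0} {xh ph : Fin nh → ℝ≥0}
    {U : Matrix (Fin ng ⊕ Fin nh) (Fin ng ⊕ Fin nh) ℂ} (hU : Solves xg pg xh ph U) :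
    IsTransfer xh ph xg pg
      ((embed (Sum.inl : Fin ng → Fin ng ⊕ Fin nh))ᴴ * Uᴴ *
        embed (Sum.inr : Fin nh → Fin ng ⊕ Fin nh)) := by
  obtain ⟨hU, hvw, hle⟩ := hU
  set G : Matrix (Fin ng ⊕ Fin nh) (Fin ng) ℂ := embed Sum.inl
  set H : Matrix (Fin ng ⊕ Fin nh) (Fin nh) ℂ := embed Sum.inr
  have hGG : Gᴴ * G = 1 := embed_isometry Sum.inl_injective
  have hHH : Hᴴ * H = 1 := embed_isometry Sum.inr_injective
  have hUU : Uᴴ * U = 1 := mem_unitaryGroup_iff'.1 hU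
  have hUU' : Uᴴᴴ * Uᴴ = 1 := by
    rw [conjTranspose_conjTranspose]
    exact mem_unitaryGroup_iff.1 hU
  have hUG : U *ᵥ (G *ᵥ ampl pg) = H *ᵥ ampl ph := by
    convert hvw using 2
    · ext (i | i)
      · exact embed_mulVec_apply Sum.inl_injective _ i
      · exact embed_mulVec_apply_of_ne _ (by simp)
    · ext (i | i)
      · exact embed_mulVec_apply_of_ne _ (by simp)
      · exact embed_mulVec_apply Sum.inr_injective _ i
  have hK : ∀ u, (Gᴴ * Uᴴ * H) *ᵥ u = (Uᴴ *ᵥ (H *ᵥ u)) ∘ Sum.inl := fun u => by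
    rw [Matrix.mul_assoc, ← mulVec_mulVec, conjTranspose_embed_mulVec, mulVec_mulVec]
  refine ⟨?_, ?_, fun u => ?_, fun u => ?_⟩
  · rw [← NNReal.coe_inj, NNReal.coe_sum, NNReal.coe_sum, ← normSq_ampl, ← normSq_ampl,
      ← normSq_mulVec_of_isometry hHH, ← hUG, normSq_mulVec_of_isometry hUU,
      normSq_mulVec_of_isometry hGG]
  · rw [← mulVec_mulVec, ← hUG, mulVec_mulVec, Matrix.mul_assoc, hUU, Matrix.mul_one,
      mulVec_mulVec, hGG, one_mulVec]
  · calc normSq ((Gᴴ * Uᴴ * H) *ᵥ u) ≤ normSq (Uᴴ *ᵥ (H *ᵥ u)) := by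
          rw [hK, ← expect_one, ← expect_one, ← obs_one, ← obs_one]
          exact expect_obs_comp_le (fun _ => zero_le_one) Sum.inl_injective _
      _ = normSq u := by rw [normSq_mulVec_of_isometry hUU', normSq_mulVec_of_isometry hHH]
  · exact expect_obs_le_of_loewnerGE_single Sum.inr_injective hle u

end Solves

section Regroup

variable {ι σ : Type} [Fintype ι] [DecidableEq σ]

/-- The total weight of the labels that are grouped into `s`. -/
def fiberWeight (f : ι → σ) (p : ι → ℝ≥0) (s : σ) : ℝ≥0 := ∑ i with f i = s, p i

theorem le_fiberWeight (f : ι → σ) (p : ι → ℝ≥0) (i : ι) : p i ≤ fiberWeight f p (f i) :=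
  Finset.single_le_sum_of_canonicallyOrdered (Finset.mem_filter.2 ⟨Finset.mem_univ i, rfl⟩)

theorem sum_fiberWeight [Fintype σ] (f : ι → σ) (p : ι → ℝ≥0) :
    ∑ s, fiberWeight f p s = ∑ i, p i :=
  Finset.sum_fiberwise _ f p

theorem sum_div_fiberWeight_le_one (f : ι → σ) (p : ι → ℝ≥0) (s : σ) :
    ∑ i with f i = s, p i / fiberWeight f p s ≤ 1 := by
  rw [← Finset.sum_div]
  exact div_self_le_one _

/-- The operator that spreads `|s⟩` over the labels grouped into `s`, in proportion to their
weights; its adjoint merges them. A group of total weight `0` is sent to `0`. -/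
def splitMatrix (f : ι → σ) (p : ι → ℝ≥0) : Matrix ι σ ℂ := fun i s =>
  if f i = s then ampl (fun i => p i / fiberWeight f p (f i)) i else 0

theorem splitMatrix_mulVec [Fintype σ] (f : ι → σ) (p : ι → ℝ≥0) (u : σ → ℂ) (i : ι) :
    (splitMatrix f p *ᵥ u) i = ampl (fun i => p i / fiberWeight f p (f i)) i * u (f i) := by
  simp [splitMatrix, mulVec, dotProduct]

theorem conjTranspose_splitMatrix_mulVec (f : ι → σ) (p : ι → ℝ≥0) (u : ι → ℂ) (s : σ) :
    ((splitMatrix f p)ᴴ *ᵥ u) s =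
      ∑ i with f i = s, ampl (fun i => p i / fiberWeight f p (f i)) i * u i := by
  simp only [mulVec, dotProduct, conjTranspose_apply, Finset.sum_filter]
  refine Finset.sum_congr rfl fun i _ => ?_
  rw [splitMatrix]
  split_ifs <;> simp [ampl]

theorem splitMatrix_mulVec_ampl [Fintype σ] (f : ι → σ) (p : ι → ℝ≥0) :
    splitMatrix f p *ᵥ ampl (fiberWeight f p) = ampl p := by
  ext i
  rw [splitMatrix_mulVec, ampl, ampl, ampl, ← Complex.ofReal_mul,
    ← Real.sqrt_mul (NNReal.coe_nonneg _), ← NNReal.coe_mul, div_mul_cancel_of_imp]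
  exact fun h => le_zero_iff.1 (h ▸ le_fiberWeight f p i)

theorem conjTranspose_splitMatrix_mulVec_ampl (f : ι → σ) (p : ι → ℝ≥0) :
    (splitMatrix f p)ᴴ *ᵥ ampl p = ampl (fiberWeight f p) := by
  ext s
  have hsplit : ∀ i, f i = s → ampl (fun i => p i / fiberWeight f p (f i)) i * ampl p i =
      ((p i / √(fiberWeight f p s) : ℝ) : ℂ) := fun i hi => by
    rw [ampl, ampl, ← Complex.ofReal_mul, hi, NNReal.coe_div, Real.sqrt_div (p i).coe_nonneg,
      div_mul_eq_mul_div, Real.mul_self_sqrt (p i).coe_nonneg]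
  rw [conjTranspose_splitMatrix_mulVec,
    Finset.sum_congr rfl fun i hi => hsplit i (Finset.mem_filter.1 hi).2, ← Complex.ofReal_sum,
    ← Finset.sum_div, ← NNReal.coe_sum, ampl]
  exact congrArg Complex.ofReal (Real.div_sqrt)

theorem norm_conjTranspose_splitMatrix_mulVec_sq_le (f : ι → σ) (p : ι → ℝ≥0) (u : ι → ℂ)
    (s : σ) :
    ‖((splitMatrix f p)ᴴ *ᵥ u) s‖ ^ 2 ≤ ∑ i with f i = s, ‖u i‖ ^ 2 := by
  set r := fun i => p i / fiberWeight f p (f i)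
  have hsum : ∑ i with f i = s, ‖ampl r i‖ ^ 2 ≤ 1 := by
    simp only [norm_ampl_sq]
    have := sum_div_fiberWeight_le_one f p s
    rw [Finset.sum_congr rfl fun i hi => by rw [← (Finset.mem_filter.1 hi).2]] at this
    exact_mod_cast this
  rw [conjTranspose_splitMatrix_mulVec]
  calc ‖∑ i with f i = s, ampl r i * u i‖ ^ 2
      ≤ (∑ i with f i = s, ‖ampl r i‖ * ‖u i‖) ^ 2 := by
        gcongr
        exact norm_sum_le_of_le _ fun i _ => (norm_mul _ _).le
    _ ≤ (∑ i with f i = s, ‖ampl r i‖ ^ 2) * ∑ i with f i = s, ‖u i‖ ^ 2 :=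
        Finset.sum_mul_sq_le_sq_mul_sq _ _ _
    _ ≤ ∑ i with f i = s, ‖u i‖ ^ 2 := mul_le_of_le_one_left (by positivity) hsum

variable [Fintype σ] [DecidableEq ι]

theorem expect_obs_splitMatrix_le (f : ι → σ) (p : ι → ℝ≥0) (w : σ → ℝ≥0) (u : σ → ℂ) :
    expect (obs fun i => w (f i)) (splitMatrix f p *ᵥ u) ≤ expect (obs fun s => w s) u := by
  simp only [expect_obs, splitMatrix_mulVec, norm_mul, mul_pow, norm_ampl_sq]
  rw [← Finset.sum_fiberwise _ f]
  refine Finset.sum_le_sum fun s _ => ?_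
  calc ∑ i with f i = s, w (f i) * (((p i / fiberWeight f p (f i) : ℝ≥0) : ℝ) * ‖u (f i)‖ ^ 2)
      = ((∑ i with f i = s, p i / fiberWeight f p s : ℝ≥0) : ℝ) * (w s * ‖u s‖ ^ 2) := by
        rw [NNReal.coe_sum, Finset.sum_mul]
        refine Finset.sum_congr rfl fun i hi => ?_
        rw [(Finset.mem_filter.1 hi).2]
        ring
    _ ≤ w s * ‖u s‖ ^ 2 :=
        mul_le_of_le_one_left (by positivity) (by exact_mod_cast sum_div_fiberWeight_le_one f p s)

theorem expect_obs_conjTranspose_splitMatrix_le (f : ι → σ) (p : ι → ℝ≥0) (w : σ → ℝ≥0)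
    (u : ι → ℂ) :
    expect (obs fun s => w s) ((splitMatrix f p)ᴴ *ᵥ u) ≤ expect (obs fun i => w (f i)) u := by
  simp only [expect_obs]
  rw [← Finset.sum_fiberwise _ f]
  refine Finset.sum_le_sum fun s _ => ?_
  calc w s * ‖((splitMatrix f p)ᴴ *ᵥ u) s‖ ^ 2 ≤ w s * ∑ i with f i = s, ‖u i‖ ^ 2 := by
        gcongr
        exact norm_conjTranspose_splitMatrix_mulVec_sq_le f p u s
    _ = ∑ i with f i = s, (w (f i) : ℝ) * ‖u i‖ ^ 2 := by
        rw [Finset.mul_sum]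
        exact Finset.sum_congr rfl fun i hi => by rw [(Finset.mem_filter.1 hi).2]

theorem isTransfer_splitMatrix (f : ι → σ) (c : σ → ℝ≥0) (p : ι → ℝ≥0) :
    IsTransfer c (fiberWeight f p) (c ∘ f) p (splitMatrix f p) where
  sum_eq := sum_fiberWeight f p
  mulVec_ampl := splitMatrix_mulVec_ampl f p
  normSq_le u := by
    simpa [obs_one, expect_one] using expect_obs_splitMatrix_le f p (fun _ => 1) u
  expect_le := expect_obs_splitMatrix_le f p c

theorem isTransfer_conjTranspose_splitMatrix (f : ι → σ) (c : σ → ℝ≥0) (p : ι → ℝ≥0) :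
    IsTransfer (c ∘ f) p c (fiberWeight f p) (splitMatrix f p)ᴴ where
  sum_eq := (sum_fiberWeight f p).symm
  mulVec_ampl := conjTranspose_splitMatrix_mulVec_ampl f p
  normSq_le u := by
    simpa [obs_one, expect_one] using expect_obs_conjTranspose_splitMatrix_le f p (fun _ => 1) u
  expect_le := expect_obs_conjTranspose_splitMatrix_le f p c

end Regroup

section TEFLine

variable {ι σ : Type} [Fintype ι] [DecidableEq σ]

theorem exists_fiberWeight_eq {x p : ι → ℝ≥0} (hp : ∀ i, 0 < p i) {c : σ → ℝ≥0}
    (hc : Function.Injective c) {g : ℝ≥0 → ℝ≥0} (hg : ∀ z, g z = ∑ i, p i * mpoint (x i) z)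
    (hgc : ∀ z, g z ≠ 0 → z ∈ Set.range c) :
    ∃ f : ι → σ, c ∘ f = x ∧ fiberWeight f p = g ∘ c := by
  have hx : ∀ i, g (x i) ≠ 0 := fun i => by
    rw [hg]
    have : p i * mpoint (x i) (x i) ≤ ∑ j, p j * mpoint (x j) (x i) :=
      Finset.single_le_sum_of_canonicallyOrdered
        (f := fun j => p j * mpoint (x j) (x i)) (Finset.mem_univ i)
    refine ((hp i).trans_le ?_).ne'
    simpa [mpoint] using this
  choose f hf using fun i => hgc _ (hx i)
  refine ⟨f, funext hf, funext fun s => ?_⟩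
  rw [Function.comp_apply, hg, fiberWeight, Finset.sum_filter]
  refine Finset.sum_congr rfl fun i _ => ?_
  simp only [mpoint, ← hf i, hc.eq_iff, mul_ite, mul_one, mul_zero, eq_comm]

theorem TEFLine.exists_isTransfer [Fintype σ] {g h : ℝ≥0 → ℝ≥0} (hgh : TEFLine g h)
    {c : σ → ℝ≥0} (hc : Function.Injective c) (hgc : ∀ z, g z ≠ 0 → z ∈ Set.range c)
    (hhc : ∀ z, h z ≠ 0 → z ∈ Set.range c) : ∃ K, IsTransfer c (h ∘ c) c (g ∘ c) K := by
  obtain ⟨nk, ng, nh, xk, pk, xg, pg, xh, ph, hpk, hpg, hph, hg, hh, U, hU⟩ := hgh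
  have hKU := hU.isTransfer.fromBlocks (.refl xk pk)
  obtain ⟨fg, hfg, hgw⟩ := exists_fiberWeight_eq (x := Sum.elim xg xk) (p := Sum.elim pg pk)
    (Sum.rec hpg hpk) hc (fun z => by simp [hg, linePoints, add_comm]) hgc
  obtain ⟨fh, hfh, hhw⟩ := exists_fiberWeight_eq (x := Sum.elim xh xk) (p := Sum.elim ph pk)
    (Sum.rec hph hpk) hc (fun z => by simp [hh, linePoints]) hhc
  rw [← hfg, ← hfh] at hKU
  rw [← hgw, ← hhw]
  exact ⟨_, ((isTransfer_conjTranspose_splitMatrix fg c _).mul hKU).mul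
    (isTransfer_splitMatrix fh c _)⟩

end TEFLine

section Dilation

variable {ι κ : Type} [Fintype ι] [Fintype κ] [DecidableEq κ]

theorem normSq_eq_norm_toLp_sq (v : ι → ℂ) : normSq v = ‖WithLp.toLp 2 v‖ ^ 2 :=
  (EuclideanSpace.norm_sq_eq _).symm

open scoped MatrixOrder in
theorem isometry_iff_normSq_mulVec {V : Matrix ι κ ℂ} :
    Vᴴ * V = 1 ↔ ∀ u, normSq (V *ᵥ u) = normSq u := by
  refine ⟨normSq_mulVec_of_isometry, fun h => ?_⟩
  have h' : ∀ u, expect (Vᴴ * V) u = expect 1 u := fun u => by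
    rw [expect_conjTranspose_mul_self, expect_one, h u]
  have hV : (Vᴴ * V).IsHermitian := isHermitian_conjTranspose_mul_self V
  exact le_antisymm (loewnerGE_of_expect_le isHermitian_one hV fun u => (h' u).le)
    (loewnerGE_of_expect_le hV isHermitian_one fun u => (h' u).ge)

open scoped MatrixOrder in
theorem exists_complement {K : Matrix κ κ ℂ} (hK : ∀ u, normSq (K *ᵥ u) ≤ normSq u) :
    ∃ D : Matrix κ κ ℂ, Kᴴ * K + Dᴴ * D = 1 := by
  have h : (1 - Kᴴ * K).PosSemidef :=
    loewnerGE_of_expect_le isHermitian_one (isHermitian_conjTranspose_mul_self K) fun u => by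
      rw [expect_conjTranspose_mul_self, expect_one]
      exact hK u
  obtain ⟨D, hD⟩ := CStarAlgebra.nonneg_iff_eq_star_mul_self.1 h.nonneg
  exact ⟨D, by rw [← star_eq_conjTranspose D, ← hD, add_sub_cancel]⟩

omit [Fintype κ] in
theorem exists_unitary_mul_eq [DecidableEq ι] [Finite κ] {J V : Matrix ι κ ℂ} (hJ : Jᴴ * J = 1)
    (hV : Vᴴ * V = 1) : ∃ U ∈ unitaryGroup ι ℂ, U * J = V := by
  cases nonempty_fintype κ
  have hnorm : ∀ {W : Matrix ι κ ℂ}, Wᴴ * W = 1 → ∀ u, ‖toEuclideanLin W u‖ = ‖u‖ :=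
    fun hW u => by
      rw [← sq_eq_sq₀ (norm_nonneg _) (norm_nonneg _)]
      exact (normSq_eq_norm_toLp_sq _).symm.trans
        ((normSq_mulVec_of_isometry hW u.ofLp).trans (normSq_eq_norm_toLp_sq _))
  let j : EuclideanSpace ℂ κ →ₗᵢ[ℂ] EuclideanSpace ℂ ι := ⟨toEuclideanLin J, hnorm hJ⟩
  let v : EuclideanSpace ℂ κ →ₗᵢ[ℂ] EuclideanSpace ℂ ι := ⟨toEuclideanLin V, hnorm hV⟩
  let w := (v.comp j.equivRange.symm.toLinearIsometry).extend
  have hwj : ∀ u, w (j u) = v u := fun u => by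
    simpa using (v.comp j.equivRange.symm.toLinearIsometry).extend_apply (j.equivRange u)
  let U : Matrix ι ι ℂ := toEuclideanLin.symm w.toLinearMap
  have hU : ∀ u : ι → ℂ, U *ᵥ u = (w (WithLp.toLp 2 u)).ofLp := fun u =>
    congrArg (fun f => (f (WithLp.toLp 2 u)).ofLp)
      (LinearEquiv.apply_symm_apply toEuclideanLin w.toLinearMap)
  refine ⟨U, mem_unitaryGroup_iff'.2 (isometry_iff_normSq_mulVec.2 fun u => ?_), ?_⟩
  · rw [normSq_eq_norm_toLp_sq, normSq_eq_norm_toLp_sq, hU, WithLp.toLp_ofLp, w.norm_map]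
  · refine mulVec_injective (funext fun u => ?_)
    rw [← mulVec_mulVec, hU]
    exact congrArg WithLp.ofLp (hwj (WithLp.toLp 2 u))

end Dilation

section Move

variable {ι κ ν : Type} [Fintype ι] [DecidableEq ι] [Fintype κ] [DecidableEq κ]

/-- One message of the honest party: the unitary `U` takes each state `ψ k` to `φ k`, the check `E`
accepts all the `φ k`, and `X`, `Y` satisfy the dual constraint of the message. The index `k` runs
over the basis labels of the other party, whose register is left alone. -/
structure IsMove (ψ φ : ν → ι → ℂ) (X Y U E : Matrix ι ι ℂ) : Prop where
  unitary : U ∈ unitaryGroup ι ℂ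
  proj : IsStarProjection E
  apply_eq : ∀ k, U *ᵥ ψ k = φ k
  check_eq : ∀ k, E *ᵥ φ k = φ k
  dual : LoewnerGE X (Uᴴ * E * Y * E * U)

theorem IsMove.submatrix {ψ φ : ν → ι → ℂ} {X Y U E : Matrix ι ι ℂ} (h : IsMove ψ φ X Y U E)
    (e : κ ≃ ι) :
    IsMove (fun k => ψ k ∘ e) (fun k => φ k ∘ e) (X.submatrix e e) (Y.submatrix e e)
      (U.submatrix e e) (E.submatrix e e) where
  unitary := by
    rw [mem_unitaryGroup_iff', star_eq_conjTranspose, conjTranspose_submatrix,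
      submatrix_mul_equiv, ← star_eq_conjTranspose, mem_unitaryGroup_iff'.1 h.unitary,
      submatrix_one_equiv]
  proj := ⟨by rw [IsIdempotentElem, submatrix_mul_equiv, h.proj.isIdempotentElem.eq],
    congrArg (fun M : Matrix ι ι ℂ => M.submatrix e e) h.proj.isSelfAdjoint.star_eq⟩
  apply_eq k := by
    rw [submatrix_mulVec_equiv, Function.comp_assoc, e.self_comp_symm, Function.comp_id,
      h.apply_eq]
  check_eq k := by
    rw [submatrix_mulVec_equiv, Function.comp_assoc, e.self_comp_symm, Function.comp_id,
      h.check_eq]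
  dual := by
    simp only [LoewnerGE, conjTranspose_submatrix, submatrix_mul_equiv]
    exact PosSemidef.submatrix h.dual e

/-- The unitary extends `J u ↦ V u`, and the check projects onto the range of `V`. -/
theorem exists_isMove_of_isometry {J V : Matrix ι κ ℂ} (hJ : Jᴴ * J = 1) (hV : Vᴴ * V = 1)
    {X Y : Matrix ι ι ℂ} (hX : X.IsHermitian) (hY : Y.IsHermitian)
    (hXY : ∀ v, expect Y (V *ᵥ (Jᴴ *ᵥ v)) ≤ expect X v) (u : ν → κ → ℂ) :
    ∃ U E, IsMove (fun k => J *ᵥ u k) (fun k => V *ᵥ u k) X Y U E := by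
  obtain ⟨U, hU, hUJ⟩ := exists_unitary_mul_eq hJ hV
  have hUU : Uᴴ * U = 1 := mem_unitaryGroup_iff'.1 hU
  have hEU : V * Vᴴ * U = V * Jᴴ := by
    have hVU : Vᴴ * U = Jᴴ := by
      rw [← hUJ, conjTranspose_mul, Matrix.mul_assoc, hUU, Matrix.mul_one]
    rw [Matrix.mul_assoc, hVU]
  refine ⟨U, V * Vᴴ, hU, ⟨?_, isHermitian_mul_conjTranspose_self V⟩, fun k => ?_, fun k => ?_, ?_⟩
  · rw [IsIdempotentElem, Matrix.mul_assoc, ← Matrix.mul_assoc Vᴴ, hV, Matrix.one_mul]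
  · rw [mulVec_mulVec, hUJ]
  · rw [mulVec_mulVec, Matrix.mul_assoc, hV, Matrix.mul_one]
  · have hdual : Uᴴ * (V * Vᴴ) * Y * (V * Vᴴ) * U = (V * Jᴴ)ᴴ * Y * (V * Jᴴ) := by
      rw [← hEU, conjTranspose_mul, conjTranspose_mul, conjTranspose_conjTranspose]
      simp only [Matrix.mul_assoc]
    rw [hdual]
    refine loewnerGE_of_expect_le hX (isHermitian_conjTranspose_mul_mul _ hY) fun v => ?_
    rw [expect_conj, ← mulVec_mulVec]
    exact hXY v

theorem isometry_embed_mul_add_embed_mul {f f₀ : κ → ι} (hf : Function.Injective f)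
    (hf₀ : Function.Injective f₀) (hff₀ : ∀ k l, f k ≠ f₀ l) {K D : Matrix κ κ ℂ}
    (hKD : Kᴴ * K + Dᴴ * D = 1) :
    (embed f * K + embed f₀ * D)ᴴ * (embed f * K + embed f₀ * D) = 1 := by
  set J := (embed f : Matrix ι κ ℂ)
  set J₀ := (embed f₀ : Matrix ι κ ℂ)
  have hJ : Jᴴ * J = 1 := embed_isometry hf
  have hJ₀ : J₀ᴴ * J₀ = 1 := embed_isometry hf₀
  have hJJ₀ : Jᴴ * J₀ = 0 := conjTranspose_embed_mul_embed_eq_zero hff₀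
  have hJ₀J : J₀ᴴ * J = 0 := conjTranspose_embed_mul_embed_eq_zero fun k l => (hff₀ l k).symm
  rw [← hKD, conjTranspose_add, conjTranspose_mul, conjTranspose_mul]
  simp only [Matrix.add_mul, Matrix.mul_add, Matrix.mul_assoc]
  simp only [← Matrix.mul_assoc Jᴴ, ← Matrix.mul_assoc J₀ᴴ, hJ, hJ₀, hJJ₀, hJ₀J,
    Matrix.one_mul, Matrix.zero_mul, Matrix.mul_zero, add_zero, zero_add]

omit [DecidableEq κ] in
/-- The part of a vector that `K` loses is sent to the labels in the range of `f₀`. -/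
theorem exists_isMove_of_contraction {K : Matrix κ κ ℂ} (hK : ∀ u, normSq (K *ᵥ u) ≤ normSq u)
    {f f₀ : κ → ι} (hf : Function.Injective f) (hf₀ : Function.Injective f₀)
    (hff₀ : ∀ k l, f k ≠ f₀ l) {X Y : Matrix ι ι ℂ} (hX : X.IsHermitian) (hY : Y.IsHermitian)
    (hXY : ∀ v b, expect Y (embed f *ᵥ (K *ᵥ (v ∘ f)) + embed f₀ *ᵥ b) ≤ expect X v)
    {u u' : ν → κ → ℂ} (hu : ∀ k, K *ᵥ u k = u' k) (hn : ∀ k, normSq (u' k) = normSq (u k)) :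
    ∃ U E, IsMove (fun k => embed f *ᵥ u k) (fun k => embed f *ᵥ u' k) X Y U E := by
  classical
  obtain ⟨D, hD⟩ := exists_complement hK
  have hV : ∀ u : κ → ℂ, (embed f * K + embed f₀ * D) *ᵥ u =
      embed f *ᵥ (K *ᵥ u) + embed f₀ *ᵥ (D *ᵥ u) := fun u => by
    rw [add_mulVec, ← mulVec_mulVec, ← mulVec_mulVec]
  have hDu : ∀ k, D *ᵥ u k = 0 := fun k => by
    have := congrArg (fun M => expect M (u k)) hD
    simp only [expect_add, expect_conjTranspose_mul_self, expect_one, hu, hn] at this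
    exact normSq_eq_zero.1 (by linarith)
  obtain ⟨U, E, hUE⟩ := exists_isMove_of_isometry (embed_isometry hf)
    (isometry_embed_mul_add_embed_mul hf hf₀ hff₀ hD) hX hY
    (fun v => by rw [hV, conjTranspose_embed_mulVec]; exact hXY v _) u
  refine ⟨U, E, ?_⟩
  simpa only [hV, hu, hDu, mulVec_zero, add_zero] using hUE

end Move

section BlockDiagonal

variable {ι κ τ : Type} [Fintype κ] [Fintype τ] [DecidableEq τ]

theorem blockDiagonal_mulVec_apply (K : τ → Matrix ι κ ℂ) (u : κ × τ → ℂ) (i : ι) (t : τ) :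
    (blockDiagonal K *ᵥ u) (i, t) = (K t *ᵥ fun k => u (k, t)) i := by
  simp [mulVec, dotProduct, blockDiagonal_apply, Fintype.sum_prod_type_right, ite_mul]

variable [Fintype ι] [DecidableEq ι] [DecidableEq κ]

theorem IsTransfer.zero {y q : κ → ℝ≥0} {x p : ι → ℝ≥0} {K : Matrix ι κ ℂ}
    (hK : IsTransfer y q x p K) : IsTransfer y 0 x 0 K where
  sum_eq := by simp
  mulVec_ampl := by
    have ampl_zero : ∀ {α : Type}, ampl (0 : α → ℝ≥0) = 0 := by intro α; ext; simp [ampl]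
    rw [ampl_zero, ampl_zero, mulVec_zero]
  normSq_le := hK.normSq_le
  expect_le := hK.expect_le

theorem isTransfer_blockDiagonal {y q : κ × τ → ℝ≥0} {x p : ι × τ → ℝ≥0} {K : τ → Matrix ι κ ℂ}
    (hK : ∀ t, IsTransfer (fun k => y (k, t)) (fun k => q (k, t)) (fun i => x (i, t))
      (fun i => p (i, t)) (K t)) :
    IsTransfer y q x p (blockDiagonal K) where
  sum_eq := by
    rw [Fintype.sum_prod_type_right, Fintype.sum_prod_type_right]
    exact Finset.sum_congr rfl fun t _ => (hK t).sum_eq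
  mulVec_ampl := by
    ext ⟨i, t⟩
    rw [blockDiagonal_mulVec_apply]
    exact congrFun (hK t).mulVec_ampl i
  normSq_le u := by
    simp only [normSq, Fintype.sum_prod_type_right, blockDiagonal_mulVec_apply]
    exact Finset.sum_le_sum fun t _ => (hK t).normSq_le _
  expect_le u := by
    simp only [expect_obs, Fintype.sum_prod_type_right, blockDiagonal_mulVec_apply]
    refine Finset.sum_le_sum fun t _ => ?_
    simpa only [expect_obs] using (hK t).expect_le fun k => u (k, t)

end BlockDiagonal

section Register

/-- The values of a certificate on a party's register, which has one basis label per coordinate and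
the extra label `none`, of value `0`. Whatever is sent to `none` is ignored by the certificate. -/
def regWeight {S : Type} (w : S → ℝ≥0) : Option S → ℝ := fun o => o.elim 0 fun s => w s

theorem regWeight_nonneg {S : Type} (w : S → ℝ≥0) (o : Option S) : 0 ≤ regWeight w o := by
  cases o
  · exact le_rfl
  · exact NNReal.coe_nonneg _

theorem expect_obs_dilation_le {ι κ : Type} [Fintype ι] [DecidableEq ι] [Fintype κ] [DecidableEq κ]
    {f f₀ : κ → ι} (hf : Function.Injective f) {w w' : ι → ℝ} (hw : ∀ i, 0 ≤ w i)
    (hw' : ∀ k, w' (f k) ≤ w (f k)) (hw₀ : ∀ k, w' (f₀ k) = 0) {K : Matrix κ κ ℂ}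
    (hK : ∀ u, expect (obs (w ∘ f)) (K *ᵥ u) ≤ expect (obs (w ∘ f)) u) (v : ι → ℂ) (b : κ → ℂ) :
    expect (obs w') (embed f *ᵥ (K *ᵥ (v ∘ f)) + embed f₀ *ᵥ b) ≤ expect (obs w) v :=
  calc expect (obs w') (embed f *ᵥ (K *ᵥ (v ∘ f)) + embed f₀ *ᵥ b)
      = expect (obs w') (embed f *ᵥ (K *ᵥ (v ∘ f))) := by
        refine expect_obs_congr fun i hi => ?_
        rw [Pi.add_apply, embed_mulVec_apply_of_ne b, add_zero]
        rintro k rfl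
        exact hi (hw₀ k)
    _ ≤ expect (obs (w ∘ f)) (K *ᵥ (v ∘ f)) := by
        rw [expect_obs_embed _ hf]
        exact expect_obs_mono hw' _
    _ ≤ expect (obs (w ∘ f)) (v ∘ f) := hK _
    _ ≤ expect (obs w) v := expect_obs_comp_le hw hf v

variable {S T : Type} [DecidableEq S] [DecidableEq T]

/-- The weights `f` on the line through `k` parallel to the first axis; `none` is no line. -/
def slice (k : Option T) (f : S × T → ℝ≥0) : S × T → ℝ≥0 := fun q =>
  if some q.2 = k then f q else 0

variable [Fintype S] [Fintype T]

/-- The state of register and message with weights `f` on the line `k`: the message holds the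
point, the register its first coordinate. -/
def lineState (f : S × T → ℝ≥0) (k : Option T) : Option S × S × T → ℂ :=
  embed (fun q => (some q.1, q)) *ᵥ ampl (slice k f)

theorem lineState_apply (f : S × T → ℝ≥0) (k : Option T) (r : Option S × S × T) :
    lineState f k r = if r.1 = some r.2.1 ∧ k = some r.2.2 then ampl f r.2 else 0 := by
  obtain ⟨a, q⟩ := r
  rcases eq_or_ne a (some q.1) with rfl | ha
  · rw [lineState, embed_mulVec_apply (f := fun q : S × T => (some q.1, q))
      fun _ _ h => congrArg Prod.snd h]
    simp only [ampl, slice, true_and, eq_comm (a := k)]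
    split_ifs <;> simp
  · rw [lineState, embed_mulVec_apply_of_ne, if_neg fun h => ha h.1]
    rintro k h
    obtain ⟨rfl, rfl⟩ := Prod.ext_iff.1 h
    exact ha rfl

theorem isTransfer_slice {c : S → ℝ≥0} {g h : S × T → ℝ≥0} {K : T → Matrix S S ℂ}
    (hK : ∀ t, IsTransfer c (fun s => h (s, t)) c (fun s => g (s, t)) (K t)) (k : Option T) :
    IsTransfer (fun q => c q.1) (slice k h) (fun q => c q.1) (slice k g) (blockDiagonal K) := by
  refine isTransfer_blockDiagonal fun t => ?_
  by_cases hk : some t = k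
  · simpa only [slice, hk, if_true] using hK t
  · simp only [slice, hk, if_false]
    exact (hK t).zero

theorem exists_isMove_lineState {c d : S → ℝ≥0} (hdc : ∀ s, d s ≤ c s) {g h : S × T → ℝ≥0}
    {K : T → Matrix S S ℂ}
    (hK : ∀ t, IsTransfer c (fun s => h (s, t)) c (fun s => g (s, t)) (K t)) :
    ∃ U E, IsMove (lineState h) (lineState g) (obs (regWeight c) ⊗ₖ (1 : Matrix (S × T) (S × T) ℂ))
      (obs (regWeight d) ⊗ₖ 1) U E := by
  have hT := isTransfer_slice hK
  have hB : IsTransfer (fun q => c q.1) h (fun q => c q.1) g (blockDiagonal K) :=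
    isTransfer_blockDiagonal hK
  have hf : Function.Injective fun q : S × T => (some q.1, q) := fun _ _ h => congrArg Prod.snd h
  simp only [← obs_one, obs_kronecker_obs, mul_one]
  refine exists_isMove_of_contraction hB.normSq_le hf (f₀ := fun q => (none, q))
    (fun _ _ h => congrArg Prod.snd h) (by simp) (isHermitian_obs _) (isHermitian_obs _)
    (expect_obs_dilation_le hf (fun p => regWeight_nonneg c p.1) (fun q => hdc q.1)
      (fun _ => rfl) hB.expect_le) (fun k => (hT k).mulVec_ampl) fun k => ?_
  rw [normSq_ampl, normSq_ampl]
  exact_mod_cast (hT k).sum_eq.symm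

end Register

section GameState

theorem injective_some_self_some {S T : Type} :
    Function.Injective fun q : S × T => (some q.1, q, some q.2) :=
  fun _ _ h => congrArg (fun p => p.2.1) h

variable {S T : Type} [Fintype S] [Fintype T] [DecidableEq S] [DecidableEq T]

/-- The state `∑ √(f (s, t)) |s⟩|s, t⟩|t⟩`: the message holds the point and each party's register
holds one of its coordinates. -/
def gameState (f : S × T → ℝ≥0) : Option S × (S × T) × Option T → ℂ :=
  embed (fun q => (some q.1, q, some q.2)) *ᵥ ampl f

theorem gameState_apply (f : S × T → ℝ≥0) (r : Option S × (S × T) × Option T) :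
    gameState f r = if r.1 = some r.2.1.1 ∧ r.2.2 = some r.2.1.2 then ampl f r.2.1 else 0 := by
  obtain ⟨a, q, b⟩ := r
  split_ifs with h
  · obtain ⟨ha : a = some q.1, hb : b = some q.2⟩ := h
    subst ha hb
    exact embed_mulVec_apply injective_some_self_some _ q
  · refine embed_mulVec_apply_of_ne _ fun k hk => h ?_
    obtain ⟨rfl, hk⟩ := Prod.ext_iff.1 hk
    obtain ⟨rfl, rfl⟩ := Prod.ext_iff.1 hk
    exact ⟨rfl, rfl⟩

theorem gameState_single (q : S × T) :
    gameState (Pi.single q 1) = Pi.single (some q.1, q, some q.2) 1 := by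
  have : ampl (Pi.single q 1) = Pi.single q 1 := by
    ext r
    rcases eq_or_ne r q with rfl | h <;> simp [ampl, *]
  rw [gameState, this, embed_mulVec_single]

theorem expect_obs_gameState (w : Option S × (S × T) × Option T → ℝ) (f : S × T → ℝ≥0) :
    expect (obs w) (gameState f) = ∑ q, w (some q.1, q, some q.2) * f q := by
  rw [gameState, expect_obs_embed _ injective_some_self_some, expect_obs_ampl]
  rfl

theorem exists_isMove_gameState_left {c d : S → ℝ≥0} (hdc : ∀ s, d s ≤ c s) {g h : S × T → ℝ≥0}
    (hgh : ∀ t, ∃ K, IsTransfer c (fun s => h (s, t)) c (fun s => g (s, t)) K) :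
    ∃ U E, IsMove (fun (b : Option T) p => gameState h (p.1, p.2, b))
      (fun b p => gameState g (p.1, p.2, b))
      (obs (regWeight c) ⊗ₖ (1 : Matrix (S × T) (S × T) ℂ)) (obs (regWeight d) ⊗ₖ 1) U E := by
  choose K hK using hgh
  convert exists_isMove_lineState hdc hK using 7 <;> rw [gameState_apply, lineState_apply]

theorem exists_isMove_gameState_right {c d : T → ℝ≥0} (hdc : ∀ t, d t ≤ c t) {g h : S × T → ℝ≥0}
    (hgh : ∀ s, ∃ K, IsTransfer c (fun t => h (s, t)) c (fun t => g (s, t)) K) :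
    ∃ U E, IsMove (fun (a : Option S) p => gameState h (a, p)) (fun a p => gameState g (a, p))
      ((1 : Matrix (S × T) (S × T) ℂ) ⊗ₖ obs (regWeight c)) (1 ⊗ₖ obs (regWeight d)) U E := by
  choose K hK using hgh
  obtain ⟨U, E, hUE⟩ := exists_isMove_lineState (g := g ∘ Prod.swap) (h := h ∘ Prod.swap) hdc hK
  let e : (S × T) × Option T ≃ Option T × T × S :=
    (Equiv.prodComm _ _).trans ((Equiv.refl _).prodCongr (Equiv.prodComm _ _))
  have he : ∀ f : S × T → ℝ≥0, (fun a p => gameState f (a, p)) =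
      fun a => lineState (f ∘ Prod.swap) a ∘ e := fun f => by
    ext a p
    simp only [gameState_apply, Function.comp_apply, lineState_apply, and_comm (b := a = _)]
    rfl
  have hobs : ∀ w : T → ℝ≥0, (1 : Matrix (S × T) (S × T) ℂ) ⊗ₖ obs (regWeight w) =
      (obs (regWeight w) ⊗ₖ 1).submatrix e e := fun w => by
    rw [← obs_one, obs_kronecker_obs, ← obs_one, obs_kronecker_obs, obs, obs,
      submatrix_diagonal_equiv]
    simp [e, Function.comp_def]
  rw [he, he, hobs, hobs]
  exact ⟨_, _, hUE.submatrix e⟩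

end GameState

section Prob

theorem mem_eigenspace_obs {ι : Type} [Fintype ι] [DecidableEq ι] {d : ι → ℝ} {z : ℝ}
    {w : EuclideanSpace ℂ ι} :
    w ∈ Module.End.eigenspace (toEuclideanLin (obs d)) (z : ℂ) ↔ ∀ i, d i ≠ z → w i = 0 := by
  have h : ∀ i, (d i : ℂ) * w i = z * w i ↔ (d i ≠ z → w i = 0) := fun i => by
    rw [mul_eq_mul_right_iff, Complex.ofReal_inj, or_iff_not_imp_left]
  rw [Module.End.mem_eigenspace_iff, WithLp.ext_iff, funext_iff]
  refine forall_congr' fun i => Iff.trans ?_ (h i)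
  rw [← congrFun (obs_mulVec d w.ofLp) i]
  rfl

theorem eigProj_obs {ι : Type} [Fintype ι] [DecidableEq ι] (d : ι → ℝ) (z : ℝ) :
    eigProj (obs d) z = obs fun i => if d i = z then 1 else 0 := by
  rw [eigProj, ← (toEuclideanCLM (n := ι) (𝕜 := ℂ)).symm_apply_apply
    (obs fun i => if d i = z then 1 else 0)]
  congr 1
  ext1 u
  refine Submodule.eq_starProjection_of_mem_of_inner_eq_zero ?_ fun w hw => ?_
  · rw [mem_eigenspace_obs]
    intro i hi
    simp [obs_mulVec, hi]
  · rw [mem_eigenspace_obs] at hw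
    rw [EuclideanSpace.inner_eq_star_dotProduct]
    refine Finset.sum_eq_zero fun i _ => ?_
    by_cases h : d i = z
    · simp [obs_mulVec, h]
    · simp [hw i h]

theorem obs_kronecker_one_kronecker_obs {a m b : Type} [DecidableEq a] [DecidableEq m]
    [DecidableEq b] (w : a → ℝ) (w' : b → ℝ) :
    obs w ⊗ₖ ((1 : Matrix m m ℂ) ⊗ₖ obs w') = obs fun r : a × m × b => w r.1 * w' r.2.2 := by
  simp only [← obs_one, obs_kronecker_obs, one_mul]

theorem prob_gameState {S T : Type} [Fintype S] [Fintype T] [DecidableEq S] [DecidableEq T]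
    (f : S × T → ℝ≥0) (w : Option S → ℝ) (w' : Option T → ℝ) (z : ℝ≥0 × ℝ≥0) :
    prob (obs w) (obs w') (gameState f) z =
      ∑ q, (if w (some q.1) = z.1 ∧ w' (some q.2) = z.2 then (f q : ℝ) else 0) := by
  rw [prob, eigProj_obs, eigProj_obs, obs_kronecker_one_kronecker_obs, expect_obs_gameState]
  simp only [mul_ite, ite_mul, mul_one, one_mul, zero_mul, mul_zero, ite_and]
  refine Finset.sum_congr rfl fun q _ => ?_
  split_ifs <;> rfl

end Prob

section Lift

variable {ι κ : Type} [Fintype ι] [Fintype κ]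

theorem kronecker_mulVec_mul (M : Matrix ι ι ℂ) (N : Matrix κ κ ℂ) (v : ι → ℂ) (w : κ → ℂ) :
    ((M ⊗ₖ N) *ᵥ fun p => v p.1 * w p.2) = fun p => (M *ᵥ v) p.1 * (N *ᵥ w) p.2 := by
  ext p
  simp only [mulVec, dotProduct, kroneckerMap_apply, Fintype.sum_prod_type, Finset.sum_mul_sum,
    mul_mul_mul_comm]

theorem star_dotProduct_kronecker_mulVec_mul (M : Matrix ι ι ℂ) (N : Matrix κ κ ℂ) (v : ι → ℂ)
    (w : κ → ℂ) :
    star (fun p : ι × κ => v p.1 * w p.2) ⬝ᵥ ((M ⊗ₖ N) *ᵥ fun p => v p.1 * w p.2) =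
      (star v ⬝ᵥ (M *ᵥ v)) * (star w ⬝ᵥ (N *ᵥ w)) := by
  rw [kronecker_mulVec_mul]
  simp only [dotProduct, Fintype.sum_prod_type, Finset.sum_mul_sum, Pi.star_apply, star_mul',
    mul_mul_mul_comm]

theorem expect_kronecker_one_mul [DecidableEq κ] (M : Matrix ι ι ℂ) (v : ι → ℂ) (w : κ → ℂ) :
    expect (M ⊗ₖ (1 : Matrix κ κ ℂ)) (fun p => v p.1 * w p.2) = expect M v * normSq w := by
  rw [expect, star_dotProduct_kronecker_mulVec_mul, one_mulVec, ← ofReal_normSq,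
    Complex.re_mul_ofReal, expect]

theorem expect_one_kronecker_mul [DecidableEq ι] (M : Matrix κ κ ℂ) (v : ι → ℂ) (w : κ → ℂ) :
    expect ((1 : Matrix ι ι ℂ) ⊗ₖ M) (fun p => v p.1 * w p.2) = normSq v * expect M w := by
  rw [expect, star_dotProduct_kronecker_mulVec_mul, one_mulVec, ← ofReal_normSq,
    Complex.re_ofReal_mul, expect]

theorem expect_kronecker_conj (M A : Matrix ι ι ℂ) (N B : Matrix κ κ ℂ) (v : ι × κ → ℂ) :
    expect (M ⊗ₖ N) ((A ⊗ₖ B) *ᵥ v) = expect ((Aᴴ * M * A) ⊗ₖ (Bᴴ * N * B)) v := by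
  rw [← expect_conj, conjTranspose_kronecker, ← mul_kronecker_mul, ← mul_kronecker_mul]

theorem LoewnerGE.kronecker_one [DecidableEq κ] {M N : Matrix ι ι ℂ} (h : LoewnerGE M N) :
    LoewnerGE (M ⊗ₖ (1 : Matrix κ κ ℂ)) (N ⊗ₖ 1) := by
  have hsub : M ⊗ₖ (1 : Matrix κ κ ℂ) - N ⊗ₖ 1 = (M - N) ⊗ₖ 1 := by ext; simp [sub_mul]
  rw [LoewnerGE, hsub]
  exact PosSemidef.kronecker h PosSemidef.one

theorem LoewnerGE.one_kronecker [DecidableEq κ] {M N : Matrix ι ι ℂ} (h : LoewnerGE M N) :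
    LoewnerGE ((1 : Matrix κ κ ℂ) ⊗ₖ M) (1 ⊗ₖ N) := by
  have hsub : (1 : Matrix κ κ ℂ) ⊗ₖ M - 1 ⊗ₖ N = 1 ⊗ₖ (M - N) := by ext; simp [mul_sub]
  rw [LoewnerGE, hsub]
  exact PosSemidef.one.kronecker h

variable {a m b : Type} [Fintype a] [Fintype m] [Fintype b]

theorem expect_kronecker_assoc (M : Matrix a a ℂ) (N : Matrix m m ℂ) (L : Matrix b b ℂ)
    (v : a × m × b → ℂ) :
    expect (M ⊗ₖ (N ⊗ₖ L)) v = expect (M ⊗ₖ N ⊗ₖ L) (v ∘ Equiv.prodAssoc a m b) := by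
  have hassoc : (M ⊗ₖ (N ⊗ₖ L)).submatrix (Equiv.prodAssoc a m b) (Equiv.prodAssoc a m b) =
      M ⊗ₖ N ⊗ₖ L := by ext; simp [mul_assoc]
  rw [← expect_submatrix (M ⊗ₖ (N ⊗ₖ L)) (Equiv.prodAssoc a m b), hassoc]

theorem liftA_mulVec_comp_prodAssoc [DecidableEq b] (X : Matrix (a × m) (a × m) ℂ)
    (v : a × m × b → ℂ) :
    (liftA X *ᵥ v) ∘ Equiv.prodAssoc a m b =
      (X ⊗ₖ (1 : Matrix b b ℂ)) *ᵥ (v ∘ Equiv.prodAssoc a m b) := by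
  rw [liftA, reindex_apply, submatrix_mulVec_equiv, Function.comp_assoc, Equiv.symm_symm,
    Equiv.symm_comp_self, Function.comp_id]

theorem liftA_mulVec_eq [DecidableEq b] {X : Matrix (a × m) (a × m) ℂ} {v w : a × m × b → ℂ}
    (h : ∀ k, (X *ᵥ fun p => v (p.1, p.2, k)) = fun p => w (p.1, p.2, k)) : liftA X *ᵥ v = w := by
  ext ⟨i, j, k⟩
  rw [← congrFun (h k) (i, j)]
  simp [mulVec, dotProduct, liftA, Fintype.sum_prod_type, one_apply]

theorem liftB_mulVec_eq [DecidableEq a] {X : Matrix (m × b) (m × b) ℂ} {v w : a × m × b → ℂ}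
    (h : ∀ i, (X *ᵥ fun p => v (i, p)) = fun p => w (i, p)) : liftB X *ᵥ v = w := by
  ext ⟨i, p⟩
  rw [← congrFun (h i) p]
  simp [mulVec, dotProduct, liftB, Fintype.sum_prod_type (α₁ := a), one_apply, ite_mul]

end Lift

section Duality

variable {a m b : Type} [Fintype a] [Fintype m] [Fintype b]
  [DecidableEq a] [DecidableEq m] [DecidableEq b]
  {P : Protocol a m b} {ZA : ℕ → Matrix a a ℂ} {ZB : ℕ → Matrix b b ℂ}

theorem Protocol.IsDualFeasible.expect_stateBobCheats_le (hZ : P.IsDualFeasible ZA ZB) {d : ℕ}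
    (χ : m × Fin d → ℂ) {V : ℕ → Matrix (m × Fin d) (m × Fin d) ℂ}
    (hV : ∀ i, V i ∈ unitaryGroup (m × Fin d) ℂ) {i : ℕ} (hi : i ≤ P.n) :
    expect (ZA i ⊗ₖ (1 : Matrix (m × Fin d) (m × Fin d) ℂ)) (P.stateBobCheats χ V i) ≤
      expect (ZA 0) P.ψA * normSq χ := by
  induction i with
  | zero => exact (expect_kronecker_one_mul (ZA 0) P.ψA χ).le
  | succ i ih =>
    refine le_trans ?_ (ih (Nat.le_of_succ_le hi))
    rw [Protocol.stateBobCheats]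
    split_ifs with hodd
    · have hE : (P.EA (i + 1))ᴴ = P.EA (i + 1) := (P.EA_proj (i + 1) hi hodd).isSelfAdjoint
      rw [← one_kronecker_one, expect_kronecker_assoc, expect_kronecker_assoc,
        liftA_mulVec_comp_prodAssoc, expect_kronecker_conj, conjTranspose_mul, hE]
      simpa only [Matrix.mul_assoc, Matrix.mul_one, conjTranspose_one] using
        (hZ.stepA i hi hodd).kronecker_one.expect_le _
    · have hVV : (V (i + 1))ᴴ * V (i + 1) = 1 := mem_unitaryGroup_iff'.1 (hV _)
      rw [liftB, expect_kronecker_conj, conjTranspose_one, Matrix.one_mul, Matrix.mul_one,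
        Matrix.mul_one, hVV, hZ.idleA i hi (Nat.not_odd_iff_even.1 hodd)]

theorem Protocol.IsDualFeasible.expect_stateAliceCheats_le (hZ : P.IsDualFeasible ZA ZB) {d : ℕ}
    (χ : Fin d × m → ℂ) {V : ℕ → Matrix (Fin d × m) (Fin d × m) ℂ}
    (hV : ∀ i, V i ∈ unitaryGroup (Fin d × m) ℂ) {i : ℕ} (hi : i ≤ P.n) :
    expect ((1 : Matrix (Fin d) (Fin d) ℂ) ⊗ₖ ((1 : Matrix m m ℂ) ⊗ₖ ZB i))
      (P.stateAliceCheats χ V i) ≤ normSq χ * expect (ZB 0) P.ψB := by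
  induction i with
  | zero =>
    rw [expect_kronecker_assoc, one_kronecker_one]
    exact (expect_one_kronecker_mul (ZB 0) χ P.ψB).le
  | succ i ih =>
    refine le_trans ?_ (ih (Nat.le_of_succ_le hi))
    rw [Protocol.stateAliceCheats]
    split_ifs with hodd
    · have hVV : (V (i + 1))ᴴ * V (i + 1) = 1 := mem_unitaryGroup_iff'.1 (hV _)
      rw [expect_kronecker_assoc, expect_kronecker_assoc, liftA_mulVec_comp_prodAssoc,
        one_kronecker_one, expect_kronecker_conj, conjTranspose_one, Matrix.one_mul,
        Matrix.mul_one, Matrix.mul_one, hVV, hZ.idleB i hi hodd]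
    · have heven := Nat.not_odd_iff_even.1 hodd
      have hE : (P.EB (i + 1))ᴴ = P.EB (i + 1) :=
        (P.EB_proj (i + 1) hi heven i.succ_pos).isSelfAdjoint
      rw [liftB, expect_kronecker_conj, conjTranspose_mul, hE]
      simpa only [Matrix.mul_assoc, Matrix.mul_one, conjTranspose_one] using
        (hZ.stepB i hi heven).one_kronecker.expect_le _

theorem Protocol.IsDualFeasible.cheatB_le (hZ : P.IsDualFeasible ZA ZB) :
    P.cheatB ≤ ENNReal.ofReal (expect (ZA 0) P.ψA) := by
  refine iSup_le fun d => iSup_le fun χ => iSup_le fun hχ => iSup_le fun V => iSup_le fun hV =>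
    ENNReal.ofReal_le_ofReal ?_
  have := hZ.expect_stateBobCheats_le χ hV le_rfl
  rwa [hZ.finalA, hχ, mul_one] at this

theorem Protocol.IsDualFeasible.cheatA_le (hZ : P.IsDualFeasible ZA ZB) :
    P.cheatA ≤ ENNReal.ofReal (expect (ZB 0) P.ψB) := by
  refine iSup_le fun d => iSup_le fun χ => iSup_le fun hχ => iSup_le fun V => iSup_le fun hV =>
    ENNReal.ofReal_le_ofReal ?_
  have := hZ.expect_stateAliceCheats_le χ hV le_rfl
  rwa [hZ.finalB, hχ, one_mul] at this

end Duality

namespace PointGame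

/-- The first coordinates of the points that occur in the game. -/
def xs (G : PointGame) : Finset ℝ≥0 :=
  (Finset.range (G.n + 1)).biUnion fun i => (G.frame i).support.image Prod.fst

/-- The second coordinates of the points that occur in the game. -/
def ys (G : PointGame) : Finset ℝ≥0 :=
  (Finset.range (G.n + 1)).biUnion fun i => (G.frame i).support.image Prod.snd

/-- A frame as a function on the finite grid that contains all points of the game. -/
def onGrid (G : PointGame) (F : Frame) (q : G.xs × G.ys) : ℝ≥0 := F (q.1, q.2)

/-- The frames of the game with the first one repeated twice more and the last one repeated forever.
During the two initial repetitions, the last two messages of the protocol, the certificates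
change from the coordinates of the points to the final measurements. -/
def padded (G : PointGame) (j : ℕ) : Frame := G.frame (min (j - 2) G.n)

/-- The number of messages of the protocol. -/
def rounds (G : PointGame) : ℕ := 2 * (G.n + 1)

variable {G : PointGame}

theorem mem_grid {j : ℕ} {z : ℝ≥0 × ℝ≥0} (hz : G.padded j z ≠ 0) : z.1 ∈ G.xs ∧ z.2 ∈ G.ys := by
  have hj : min (j - 2) G.n ∈ Finset.range (G.n + 1) := by simp
  have hz' := Finsupp.mem_support_iff.2 hz
  exact ⟨Finset.mem_biUnion.2 ⟨_, hj, Finset.mem_image_of_mem _ hz'⟩,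
    Finset.mem_biUnion.2 ⟨_, hj, Finset.mem_image_of_mem _ hz'⟩⟩

theorem padded_of_le_two {j : ℕ} (hj : j ≤ 2) :
    G.padded j = Finsupp.single (0, 1) (1 / 2) + Finsupp.single (1, 0) (1 / 2) := by
  rw [padded, Nat.sub_eq_zero_of_le hj, Nat.zero_min, G.initial]

theorem padded_rounds : G.padded G.rounds = Finsupp.single (G.β, G.α) 1 := by
  rw [padded, min_eq_right (by rw [rounds]; omega), G.final]

theorem padded_eq_succ_or (j : ℕ) :
    G.padded j = G.padded (j + 1) ∨ ∃ i < G.n, j = i + 2 ∧ G.padded j = G.frame i ∧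
      G.padded (j + 1) = G.frame (i + 1) := by
  by_cases h : 2 ≤ j ∧ j - 2 < G.n
  · refine Or.inr ⟨j - 2, h.2, by omega, ?_, ?_⟩ <;> rw [padded] <;> congr 1 <;> omega
  · left
    rw [padded, padded]
    congr 1
    omega

theorem sum_mul_onGrid (j : ℕ) (φ : ℝ≥0 × ℝ≥0 → ℝ) :
    ∑ q : G.xs × G.ys, φ (q.1, q.2) * G.onGrid (G.padded j) q =
      (G.padded j).sum fun z p => φ z * p := by
  have hinj : Function.Injective fun q : G.xs × G.ys => ((q.1 : ℝ≥0), (q.2 : ℝ≥0)) :=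
    Subtype.val_injective.prodMap Subtype.val_injective
  refine (Finset.sum_map Finset.univ ⟨_, hinj⟩ fun z => φ z * (G.padded j z : ℝ)).symm.trans ?_
  refine (Finset.sum_subset (fun z hz => ?_) fun z _ hz => ?_).symm
  · obtain ⟨hx, hy⟩ := mem_grid (Finsupp.mem_support_iff.1 hz)
    exact Finset.mem_map.2 ⟨(⟨z.1, hx⟩, ⟨z.2, hy⟩), Finset.mem_univ _, rfl⟩
  · rw [Finsupp.notMem_support_iff.1 hz, NNReal.coe_zero, mul_zero]

theorem sum_mul_onGrid_initial (φ : ℝ≥0 × ℝ≥0 → ℝ) :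
    ∑ q : G.xs × G.ys, φ (q.1, q.2) * G.onGrid (G.padded 0) q = (φ (0, 1) + φ (1, 0)) / 2 := by
  rw [sum_mul_onGrid, padded_of_le_two zero_le_two,
    Finsupp.sum_add_index' (by simp) (by simp [mul_add]), Finsupp.sum_single_index (by simp),
    Finsupp.sum_single_index (by simp)]
  simp only [NNReal.coe_div, NNReal.coe_one, NNReal.coe_ofNat]
  ring

theorem IsTEF.exists_isTransfer_left (hG : G.IsTEF) {j : ℕ} (hj : Odd j) (t : G.ys) :
    ∃ K, IsTransfer (fun s : G.xs => (s : ℝ≥0)) (fun s => G.onGrid (G.padded (j + 1)) (s, t))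
      (fun s : G.xs => (s : ℝ≥0)) (fun s => G.onGrid (G.padded j) (s, t)) K := by
  rcases padded_eq_succ_or (G := G) j with h | ⟨i, hi, rfl, hgi, hgi'⟩
  · rw [h]
    exact ⟨_, IsTransfer.refl _ _⟩
  · have hline := (hG i hi).2 (by simpa [Nat.odd_add] using hj) t
    rw [← hgi, ← hgi'] at hline
    exact hline.exists_isTransfer Subtype.val_injective
      (fun z hz => ⟨⟨z, (mem_grid hz).1⟩, rfl⟩) (fun z hz => ⟨⟨z, (mem_grid hz).1⟩, rfl⟩)

theorem IsTEF.exists_isTransfer_right (hG : G.IsTEF) {j : ℕ} (hj : Even j) (s : G.xs) :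
    ∃ K, IsTransfer (fun t : G.ys => (t : ℝ≥0)) (fun t => G.onGrid (G.padded (j + 1)) (s, t))
      (fun t : G.ys => (t : ℝ≥0)) (fun t => G.onGrid (G.padded j) (s, t)) K := by
  rcases padded_eq_succ_or (G := G) j with h | ⟨i, hi, rfl, hgi, hgi'⟩
  · rw [h]
    exact ⟨_, IsTransfer.refl _ _⟩
  · have hline := (hG i hi).1 (by simpa [Nat.even_add] using hj) s
    rw [← hgi, ← hgi'] at hline
    exact hline.exists_isTransfer Subtype.val_injective
      (fun z hz => ⟨⟨z, (mem_grid hz).2⟩, rfl⟩) (fun z hz => ⟨⟨z, (mem_grid hz).2⟩, rfl⟩)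

end PointGame

section Certificates

/-- The eigenvalue that the certificate after `i` messages has at the coordinate `x`: the coordinate
itself before message `k`, and from then on the indicator of `1`, the value measured at the end. -/
def cert (k i : ℕ) (x : ℝ≥0) : ℝ≥0 := if k ≤ i then mpoint 1 x else x

theorem cert_of_lt {k i : ℕ} (h : i < k) (x : ℝ≥0) : cert k i x = x := if_neg h.not_ge

theorem cert_self (k : ℕ) : cert k k = mpoint 1 := funext fun _ => if_pos le_rfl

theorem cert_le (k i : ℕ) (x : ℝ≥0) : cert k i x ≤ x := by
  simp only [cert, mpoint]
  split_ifs <;> simp_all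

theorem cert_zero_right (k i : ℕ) : cert k i 0 = 0 := le_antisymm (cert_le k i 0) zero_le

theorem cert_one_right (k i : ℕ) : cert k i 1 = 1 := by simp [cert, mpoint]

theorem cert_eq_of_padded_ne_zero {G : PointGame} {k j : ℕ} (hk : G.rounds ≤ k + 1)
    (hj : j ≤ G.rounds) {z : ℝ≥0 × ℝ≥0} (hz : G.padded j z ≠ 0) :
    cert k (G.rounds - j) z.1 = z.1 ∧ cert k (G.rounds - j) z.2 = z.2 := by
  rcases lt_or_ge (G.rounds - j) k with h | h
  · exact ⟨cert_of_lt h _, cert_of_lt h _⟩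
  · rw [PointGame.padded_of_le_two (by omega), Finsupp.add_apply, Finsupp.single_apply,
      Finsupp.single_apply] at hz
    have hz' : z = (0, 1) ∨ z = (1, 0) := by
      contrapose! hz
      rw [if_neg hz.1.symm, if_neg hz.2.symm, add_zero]
    rcases hz' with rfl | rfl <;> simp only [cert_zero_right, cert_one_right, and_self]

variable (G : PointGame)

/-- Alice's dual certificates. They change at message `rounds - 1`, the last one she sends. -/
def certA (i : ℕ) : Matrix (Option G.xs) (Option G.xs) ℂ :=
  obs (regWeight fun s => cert (G.rounds - 1) i s)

/-- Bob's dual certificates. They change at message `rounds`, the last one he sends. -/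
def certB (i : ℕ) : Matrix (Option G.ys) (Option G.ys) ℂ :=
  obs (regWeight fun t => cert G.rounds i t)

end Certificates

section Realization

/-- The honest state after `i` messages: the protocol runs through the frames backwards. -/
def frameState (G : PointGame) (i : ℕ) : Option G.xs × (G.xs × G.ys) × Option G.ys → ℂ :=
  gameState (G.onGrid (G.padded (G.rounds - i)))

/-- Unitaries and checks for all messages of a protocol whose honest states are the `frameState`s,
for which `certA` and `certB` are dual feasible. -/
structure Realization (G : PointGame) where
  UA : ℕ → Matrix (Option G.xs × (G.xs × G.ys)) (Option G.xs × (G.xs × G.ys)) ℂ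
  EA : ℕ → Matrix (Option G.xs × (G.xs × G.ys)) (Option G.xs × (G.xs × G.ys)) ℂ
  UB : ℕ → Matrix ((G.xs × G.ys) × Option G.ys) ((G.xs × G.ys) × Option G.ys) ℂ
  EB : ℕ → Matrix ((G.xs × G.ys) × Option G.ys) ((G.xs × G.ys) × Option G.ys) ℂ
  alice : ∀ i < G.rounds, Odd (i + 1) →
    IsMove (fun b p => frameState G i (p.1, p.2, b)) (fun b p => frameState G (i + 1) (p.1, p.2, b))
      (certA G i ⊗ₖ 1) (certA G (i + 1) ⊗ₖ 1) (UA (i + 1)) (EA (i + 1))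
  bob : ∀ i < G.rounds, Even (i + 1) →
    IsMove (fun a p => frameState G i (a, p)) (fun a p => frameState G (i + 1) (a, p))
      (1 ⊗ₖ certB G i) (1 ⊗ₖ certB G (i + 1)) (UB (i + 1)) (EB (i + 1))

variable {G : PointGame}

theorem even_rounds : Even G.rounds := even_two_mul _

theorem PointGame.IsTEF.exists_isMove_alice (hG : G.IsTEF) {i : ℕ} (hi : i < G.rounds)
    (hodd : Odd (i + 1)) :
    ∃ U E, IsMove (fun b p => frameState G i (p.1, p.2, b))
      (fun b p => frameState G (i + 1) (p.1, p.2, b)) (certA G i ⊗ₖ 1)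
      (certA G (i + 1) ⊗ₖ 1) U E := by
  have hi' : i + 1 < G.rounds := lt_of_le_of_ne hi fun h =>
    Nat.not_even_iff_odd.2 hodd (h ▸ even_rounds)
  have hj : Odd (G.rounds - (i + 1)) := Nat.Even.sub_odd hi even_rounds hodd
  have hcert : (fun s : G.xs => cert (G.rounds - 1) i s) = fun s : G.xs => (s : ℝ≥0) :=
    funext fun s => cert_of_lt (by omega) _
  rw [certA, hcert, frameState, show G.rounds - i = G.rounds - (i + 1) + 1 by omega]
  exact exists_isMove_gameState_left (fun s => cert_le _ _ _) (hG.exists_isTransfer_left hj)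

theorem PointGame.IsTEF.exists_isMove_bob (hG : G.IsTEF) {i : ℕ} (hi : i < G.rounds)
    (heven : Even (i + 1)) :
    ∃ U E, IsMove (fun a p => frameState G i (a, p)) (fun a p => frameState G (i + 1) (a, p))
      (1 ⊗ₖ certB G i) (1 ⊗ₖ certB G (i + 1)) U E := by
  have hj : Even (G.rounds - (i + 1)) := (Nat.even_sub hi).2 (iff_of_true even_rounds heven)
  have hcert : (fun t : G.ys => cert G.rounds i t) = fun t : G.ys => (t : ℝ≥0) :=
    funext fun t => cert_of_lt hi _
  rw [certB, hcert, frameState, show G.rounds - i = G.rounds - (i + 1) + 1 by omega]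
  exact exists_isMove_gameState_right (fun t => cert_le _ _ _) (hG.exists_isTransfer_right hj)

theorem PointGame.IsTEF.nonempty_realization (hG : G.IsTEF) : Nonempty (Realization G) := by
  choose! UA EA hA using fun i (hi : i < G.rounds) (h : Odd (i + 1)) => hG.exists_isMove_alice hi h
  choose! UB EB hB using fun i (hi : i < G.rounds) (h : Even (i + 1)) => hG.exists_isMove_bob hi h
  exact ⟨⟨fun i => UA (i - 1), fun i => EA (i - 1), fun i => UB (i - 1), fun i => EB (i - 1),
    hA, hB⟩⟩

theorem final_mem_grid : G.β ∈ G.xs ∧ G.α ∈ G.ys :=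
  PointGame.mem_grid (j := G.rounds) (z := (G.β, G.α)) (by simp [PointGame.padded_rounds])

/-- The final point of the game as a point of the grid. -/
def finalPoint (G : PointGame) : G.xs × G.ys := (⟨G.β, final_mem_grid.1⟩, ⟨G.α, final_mem_grid.2⟩)

theorem frameState_zero : frameState G 0 =
    Pi.single (some (finalPoint G).1, finalPoint G, some (finalPoint G).2) 1 := by
  rw [← gameState_single, frameState, Nat.sub_zero, PointGame.padded_rounds]
  congr 1
  ext q
  simp [PointGame.onGrid, Finsupp.single_apply, Pi.single_apply, finalPoint, Prod.ext_iff,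
    Subtype.ext_iff, eq_comm]

theorem certA_succ {i : ℕ} (heven : Even (i + 1)) : certA G i = certA G (i + 1) := by
  obtain ⟨k, hk⟩ := heven
  have : G.rounds - 1 ≤ i ↔ G.rounds - 1 ≤ i + 1 := by rw [PointGame.rounds]; omega
  simp only [certA, cert, this]

theorem certB_succ {i : ℕ} (hodd : Odd (i + 1)) : certB G i = certB G (i + 1) := by
  obtain ⟨k, hk⟩ := hodd
  have : G.rounds ≤ i ↔ G.rounds ≤ i + 1 := by rw [PointGame.rounds]; omega
  simp only [certB, cert, this]

/-- The probability that a party measures the coordinate `1` at the end, for each label of its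
register. This is Alice's outcome `1` and Bob's outcome `0`. -/
def oneWeight {s : Finset ℝ≥0} : Option s → ℝ := regWeight fun x => mpoint 1 x

theorem certA_rounds : certA G G.rounds = obs oneWeight := by
  have : cert (G.rounds - 1) G.rounds = mpoint 1 := funext fun _ => if_pos (Nat.sub_le _ _)
  rw [certA, this, oneWeight]

theorem certB_rounds : certB G G.rounds = obs oneWeight := by
  rw [certB, cert_self, oneWeight]

theorem oneWeight_le_one {s : Finset ℝ≥0} (o : Option s) : oneWeight o ≤ 1 := by
  rcases o with _ | x
  · exact zero_le_one
  · simp only [oneWeight, regWeight, mpoint, Option.elim]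
    split_ifs <;> simp

theorem posSemidef_obs_one_sub_oneWeight {s : Finset ℝ≥0} :
    (obs (1 - oneWeight : Option s → ℝ)).PosSemidef :=
  posSemidef_obs fun o => sub_nonneg.2 (oneWeight_le_one o)

theorem posSemidef_obs_oneWeight {s : Finset ℝ≥0} : (obs (oneWeight : Option s → ℝ)).PosSemidef :=
  posSemidef_obs (regWeight_nonneg _)

namespace Realization

variable (R : Realization G)

/-- The protocol of a realization, before its properties are verified. -/
def protocolData : ProtocolData (Option G.xs) (G.xs × G.ys) (Option G.ys) where
  n := G.rounds
  ψA := Pi.single (some (finalPoint G).1) 1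
  ψM := Pi.single (finalPoint G) 1
  ψB := Pi.single (some (finalPoint G).2) 1
  UA := R.UA
  UB := R.UB
  EA := R.EA
  EB := R.EB
  PA j := obs (![1 - oneWeight, oneWeight] j)
  PB j := obs (![oneWeight, 1 - oneWeight] j)

theorem honest_eq {i : ℕ} (hi : i ≤ G.rounds) : R.protocolData.honest i = frameState G i := by
  induction i with
  | zero =>
    ext r
    simp only [frameState_zero, ProtocolData.honest, protocolData, Pi.single_apply, Prod.ext_iff,
      mul_ite, mul_one, mul_zero]
    grind
  | succ i ih =>
    rw [ProtocolData.honest, ih (Nat.le_of_succ_le hi)]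
    split_ifs with hodd
    · exact liftA_mulVec_eq (R.alice i hi hodd).apply_eq
    · exact liftB_mulVec_eq (R.bob i hi (Nat.not_odd_iff_even.1 hodd)).apply_eq

theorem normSq_joint_mulVec_honest (j k : Fin 2) :
    normSq (R.protocolData.joint j k *ᵥ R.protocolData.honest G.rounds) =
      if j = k then 1 / 2 else 0 := by
  let φ (z : ℝ≥0 × ℝ≥0) : ℝ :=
    (![1 - (mpoint 1 z.1 : ℝ), mpoint 1 z.1] j * ![(mpoint 1 z.2 : ℝ), 1 - mpoint 1 z.2] k) ^ 2
  calc normSq (R.protocolData.joint j k *ᵥ R.protocolData.honest G.rounds)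
      = ∑ q : G.xs × G.ys, φ (q.1, q.2) * G.onGrid (G.padded 0) q := by
        rw [R.honest_eq le_rfl, frameState, Nat.sub_self, ProtocolData.joint, protocolData,
          obs_kronecker_one_kronecker_obs, normSq_obs_mulVec, expect_obs_gameState]
        refine Finset.sum_congr rfl fun q _ => ?_
        fin_cases j <;> fin_cases k <;> rfl
    _ = (φ (0, 1) + φ (1, 0)) / 2 := PointGame.sum_mul_onGrid_initial φ
    _ = if j = k then 1 / 2 else 0 := by fin_cases j <;> fin_cases k <;> simp [φ, mpoint]

theorem liftA_EA_mulVec_honest {i : ℕ} (hi : i ≤ G.rounds) (hodd : Odd i) :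
    liftA (R.EA i) *ᵥ R.protocolData.honest i = R.protocolData.honest i := by
  obtain ⟨i, rfl⟩ := Nat.exists_eq_add_one.2 hodd.pos
  rw [R.honest_eq hi]
  exact liftA_mulVec_eq (R.alice i hi hodd).check_eq

theorem liftB_EB_mulVec_honest {i : ℕ} (hi : i ≤ G.rounds) (heven : Even i) (hpos : 0 < i) :
    liftB (R.EB i) *ᵥ R.protocolData.honest i = R.protocolData.honest i := by
  obtain ⟨i, rfl⟩ := Nat.exists_eq_add_one.2 hpos
  rw [R.honest_eq hi]
  exact liftB_mulVec_eq (R.bob i hi heven).check_eq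

/-- The protocol of a realization. -/
def protocol : Protocol (Option G.xs) (G.xs × G.ys) (Option G.ys) where
  toProtocolData := R.protocolData
  n_even := even_rounds
  ψA_unit := normSq_single _
  ψM_unit := normSq_single _
  ψB_unit := normSq_single _
  UA_unitary
    | i + 1, hi, hodd => (R.alice i hi hodd).unitary
  UB_unitary
    | i + 1, hi, heven, _ => (R.bob i hi heven).unitary
  EA_proj
    | i + 1, hi, hodd => (R.alice i hi hodd).proj
  EB_proj
    | i + 1, hi, heven, _ => (R.bob i hi heven).proj
  EA_honest _ := R.liftA_EA_mulVec_honest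
  EB_honest _ := R.liftB_EB_mulVec_honest
  PA_psd := Fin.forall_fin_two.2 ⟨posSemidef_obs_one_sub_oneWeight, posSemidef_obs_oneWeight⟩
  PB_psd := Fin.forall_fin_two.2 ⟨posSemidef_obs_oneWeight, posSemidef_obs_one_sub_oneWeight⟩
  PA_sum := (obs_add _ _).trans <| (congrArg obs (sub_add_cancel _ _)).trans obs_one
  PB_sum := (obs_add _ _).trans <| (congrArg obs (add_sub_cancel _ _)).trans obs_one
  correct₀₁ := normSq_eq_zero.1 (R.normSq_joint_mulVec_honest 0 1)
  correct₁₀ := normSq_eq_zero.1 (R.normSq_joint_mulVec_honest 1 0)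
  balanced₀ := R.normSq_joint_mulVec_honest 0 0
  balanced₁ := R.normSq_joint_mulVec_honest 1 1

theorem isDualFeasible : R.protocol.IsDualFeasible (certA G) (certB G) where
  psdA _ _ := posSemidef_obs (regWeight_nonneg _)
  psdB _ _ := posSemidef_obs (regWeight_nonneg _)
  stepA i hi hodd := (R.alice i hi hodd).dual
  stepB i hi heven := (R.bob i hi heven).dual
  idleA _ _ := certA_succ
  idleB _ _ := certB_succ
  finalA := certA_rounds
  finalB := certB_rounds

theorem prob_eq {j : ℕ} (hj : j ≤ G.rounds) (z : ℝ≥0 × ℝ≥0) :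
    prob (certA G (G.rounds - j)) (certB G (G.rounds - j)) (R.protocol.honest (G.rounds - j)) z =
      G.padded j z := by
  have hhonest : R.protocol.honest (G.rounds - j) = frameState G (G.rounds - j) :=
    R.honest_eq (Nat.sub_le _ _)
  rw [hhonest, frameState, Nat.sub_sub_self hj, certA, certB, prob_gameState]
  calc _ = ∑ q : G.xs × G.ys, (if ((q.1 : ℝ≥0), (q.2 : ℝ≥0)) = z then 1 else 0 : ℝ) *
          G.onGrid (G.padded j) q := Finset.sum_congr rfl fun q _ => ?_
    _ = (G.padded j).sum fun w p => (if w = z then 1 else 0 : ℝ) * p :=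
        PointGame.sum_mul_onGrid j fun w => if w = z then 1 else 0
    _ = G.padded j z := by simpa [Finsupp.sum] using fun h => by simp [h]
  rcases eq_or_ne (G.onGrid (G.padded j) q) 0 with hq | hq
  · simp [hq]
  · have hA : cert (G.rounds - 1) (G.rounds - j) q.1 = q.1 :=
      (cert_eq_of_padded_ne_zero (k := G.rounds - 1) (by omega) hj hq).1
    have hB : cert G.rounds (G.rounds - j) q.2 = q.2 :=
      (cert_eq_of_padded_ne_zero (k := G.rounds) (by omega) hj hq).2
    simp [regWeight, hA, hB, Prod.ext_iff]

theorem hasPointGame : R.protocol.HasPointGame (certA G) (certB G) G := by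
  have hrounds : R.protocol.n = 2 * (G.n + 1) := rfl
  refine ⟨fun j => ⟨min (j - 2) G.n, by omega⟩, fun i j hij => Fin.mk_le_mk.2 ?_,
    fun k => ⟨⟨k + 2, by omega⟩, Fin.ext ?_⟩, fun j z => R.prob_eq (Nat.le_of_lt_succ j.2) z⟩
  · have : (i : ℕ) ≤ j := hij
    omega
  · simp only
    omega

theorem expect_certA_zero : expect (certA G 0) R.protocol.ψA = G.β := by
  have hpos : 0 < G.rounds - 1 := by rw [PointGame.rounds]; omega
  exact (expect_obs_single _ _).trans (congrArg NNReal.toReal (cert_of_lt hpos _))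

theorem expect_certB_zero : expect (certB G 0) R.protocol.ψB = G.α := by
  have hpos : 0 < G.rounds := by rw [PointGame.rounds]; omega
  exact (expect_obs_single _ _).trans (congrArg NNReal.toReal (cert_of_lt hpos _))

end Realization

end Realization

end WCF

end

theorem mainTheorem2 (G : WCF.PointGame) (hG : G.IsTEF) :
    ∃ (a m b : Type) (_ : Fintype a) (_ : Fintype m) (_ : Fintype b)
      (_ : DecidableEq a) (_ : DecidableEq m) (_ : DecidableEq b)
      (P : WCF.Protocol a m b) (ZA : ℕ → Matrix a a ℂ) (ZB : ℕ → Matrix b b ℂ),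
      P.IsDualFeasible ZA ZB ∧
      P.HasPointGame ZA ZB G ∧
      WCF.expect (ZA 0) P.ψA = (G.β : ℝ) ∧
      WCF.expect (ZB 0) P.ψB = (G.α : ℝ) ∧
      P.cheatB ≤ (G.β : ℝ≥0∞) ∧
      P.cheatA ≤ (G.α : ℝ≥0∞) := by
  obtain ⟨R⟩ := hG.nonempty_realization
  have hZ := R.isDualFeasible
  have hβ := R.expect_certA_zero
  have hα := R.expect_certB_zero
  refine ⟨_, _, _, inferInstance, inferInstance, inferInstance, inferInstance, inferInstance,
    inferInstance, R.protocol, WCF.certA G, WCF.certB G, hZ, R.hasPointGame, hβ, hα, ?_, ?_⟩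
  · simpa only [hβ, ENNReal.ofReal_coe_nnreal] using hZ.cheatB_le
  · simpa only [hα, ENNReal.ofReal_coe_nnreal] using hZ.cheatA_le
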